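/- Let $\mathbb K=\mathbb R$ or $\mathbb C$; $B_X$ is the closed unit ball of $X$, and isometric embeddings of Banach spaces below are $\mathbb K$-linear. For Banach spaces $X,Y$ over $\mathbb K$: * $d_K(X,Y)$ is the infimum of the Hausdorff distances between (the images of) $B_X$ and $B_Y$ over all linear isometric embeddings of $X$ and $Y$ into a common Banach space. * For $0<r<1$, an $r$-norm on a vector space $Z$ is a map $\|\cdot\|$ with $\|z\|>0$ for $z\ne0$, $\|\alpha z\|=|\alpha|\|z\|$ and $\|z_1+z_2\|^r\le\|z_1\|^r+\|z_2\|^r$; $Z$ is an $r$-normed quasi-Banach space if it is complete for the metric $\|z_1-z_2\|^r$. Then $d_r(X,Y)$ is the infimum of $$\max\Big\{\sup_{a\in B_X}\inf_{b\in B_Y}\|a-b\|_Z,\ \sup_{b\in B_Y}\inf_{a\in B_X}\|a-b\|_Z\Big\}$$ over all linear isometric embeddings of $X$ and $Y$ into a common $r$-normed quasi-Banach space $Z$. * $d_{GH}(X,Y)$ is the Gromov–Hausdorff distance between the metric spaces $B_X$ and $B_Y$, i.e. the infimum of the Hausdorff distances of their images over all isometric (not necessarily linear) embeddings of $B_X$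 and $B_Y$ into a common pseudo-metric space. * $X$ is a $\mathcal K_0$-space if there is a constant $\kappa\ge0$ such that for every function $f:X\to\mathbb K$ with $f(\alpha x)=\alpha f(x)$ for $\alpha\in\mathbb K$, bounded on $B_X$ and satisfying $|f(x_1+x_2)-f(x_1)-f(x_2)|\le\|x_1\|+\|x_2\|$ for all $x_1,x_2\in X$, there is $x^*\in X^*$ with $|f(x)-x^*(x)|\le\kappa\|x\|$ for all $x\in X$. The best such constant is denoted by $\kappa_0(X)$. **Theorem.** (1) For every $0<r<1$ there is a constant $C=C(r)$ such that for every $\mathcal K_0$-space $X$ of dimension at least $2$ and every Banach space $Y$ (over the same scalar field), $$d_K(X,Y)\le C\,\kappa_0(X)\,d_r(X,Y).$$ (2) If $X$ is a real $\mathcal K_0$-space and $(X_n)$ is a sequence of real Banach spaces with $\lim_{n\to\infty}d_{GH}(X_n,X)=0$, then $\lim_{n\to\infty}d_K(X_n,X)=0$. -/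

import Mathlib

universe u v w

namespace BanachDist

/-- The Kadets distance `d_K(X, Y)`: the infimum of the Hausdorff distances between the images of
the closed unit balls over all linear isometric embeddings of `X` and `Y` into a common Banach
space `Z`. The universe of `Z` is no restriction, since `Z` may be replaced by the closed linear
span of the images of `X` and `Y`. -/
noncomputable def kadetsDist (𝕜 : Type w) [RCLike 𝕜]
    (X : Type u) [NormedAddCommGroup X] [NormedSpace 𝕜 X]
    (Y : Type v) [NormedAddCommGroup Y] [NormedSpace 𝕜 Y] : ℝ :=
  sInf {δ : ℝ | ∃ (Z : Type (max u v)) (_ : NormedAddCommGroup Z) (_ : NormedSpace 𝕜 Z)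
    (_ : CompleteSpace Z) (U : X →ₗᵢ[𝕜] Z) (V : Y →ₗᵢ[𝕜] Z),
    δ = Metric.hausdorffDist (U '' Metric.closedBall 0 1) (V '' Metric.closedBall 0 1)}

/-- `N` is an `r`-norm on the vector space `Z`. -/
structure IsRNorm (𝕜 : Type w) [RCLike 𝕜] {Z : Type u} [AddCommGroup Z] [Module 𝕜 Z]
    (r : ℝ) (N : Z → ℝ) : Prop where
  pos : ∀ z : Z, z ≠ 0 → 0 < N z
  smul : ∀ (a : 𝕜) (z : Z), N (a • z) = ‖a‖ * N z
  add_rpow_le : ∀ z₁ z₂ : Z, N (z₁ + z₂) ^ r ≤ N z₁ ^ r + N z₂ ^ r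

/-- Completeness of `Z` for the metric `(z₁, z₂) ↦ N (z₁ - z₂) ^ r`. -/
def IsRComplete {Z : Type u} [AddCommGroup Z] (r : ℝ) (N : Z → ℝ) : Prop :=
  ∀ s : ℕ → Z, (∀ ε > 0, ∃ n₀ : ℕ, ∀ m ≥ n₀, ∀ n ≥ n₀, N (s m - s n) ^ r < ε) →
    ∃ z : Z, Filter.Tendsto (fun n => N (s n - z) ^ r) Filter.atTop (nhds 0)

/-- The Hausdorff distance of two sets with respect to the gauge `N (a - b)`. -/
noncomputable def gaugeHausdorffDist {Z : Type u} [AddCommGroup Z] (N : Z → ℝ) (A B : Set Z) : ℝ :=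
  max (⨆ a : A, ⨅ b : B, N ((a : Z) - b)) (⨆ b : B, ⨅ a : A, N ((a : Z) - b))

/-- The distance `d_r(X, Y)`: the infimum of the Hausdorff distances, measured with the `r`-norm,
between the images of the closed unit balls over all linear isometric embeddings of `X` and `Y`
into a common `r`-normed quasi-Banach space `(Z, N)`. -/
noncomputable def rDist (𝕜 : Type w) [RCLike 𝕜] (r : ℝ)
    (X : Type u) [NormedAddCommGroup X] [NormedSpace 𝕜 X]
    (Y : Type v) [NormedAddCommGroup Y] [NormedSpace 𝕜 Y] : ℝ :=
  sInf {δ : ℝ | ∃ (Z : Type (max u v)) (_ : AddCommGroup Z) (_ : Module 𝕜 Z) (N : Z → ℝ)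
    (U : X →ₗ[𝕜] Z) (V : Y →ₗ[𝕜] Z),
    IsRNorm 𝕜 r N ∧ IsRComplete r N ∧ (∀ x, N (U x) = ‖x‖) ∧ (∀ y, N (V y) = ‖y‖) ∧
    δ = gaugeHausdorffDist N (U '' Metric.closedBall 0 1) (V '' Metric.closedBall 0 1)}

/-- The Gromov-Hausdorff distance of two (nonempty, bounded) metric spaces. -/
noncomputable def gromovHausdorffDist (A : Type u) [PseudoMetricSpace A]
    (B : Type v) [PseudoMetricSpace B] : ℝ :=
  sInf {ε : ℝ | 0 ≤ ε ∧ ∃ (M : Type (max u v)) (_ : PseudoMetricSpace M) (i : A → M) (j : B → M),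
    Isometry i ∧ Isometry j ∧ Metric.hausdorffDist (Set.range i) (Set.range j) ≤ ε}

/-- `d_GH(X, Y)`: the Gromov-Hausdorff distance between the closed unit balls. -/
noncomputable def ballGHDist (X : Type u) [NormedAddCommGroup X]
    (Y : Type v) [NormedAddCommGroup Y] : ℝ :=
  gromovHausdorffDist (Metric.closedBall (0 : X) 1) (Metric.closedBall (0 : Y) 1)

/-- `κ` is an admissible constant for `X`: every homogeneous scalar function on `X` that is bounded
on the unit ball and satisfies `|f (x₁ + x₂) - f x₁ - f x₂| ≤ ‖x₁‖ + ‖x₂‖` is within `κ ‖x‖` of a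
continuous linear functional. -/
def IsK0Constant (𝕜 : Type w) [RCLike 𝕜] (X : Type u) [NormedAddCommGroup X] [NormedSpace 𝕜 X]
    (κ : ℝ) : Prop :=
  ∀ f : X → 𝕜, (∀ (a : 𝕜) (x : X), f (a • x) = a * f x) →
    (∃ M : ℝ, ∀ x : X, ‖x‖ ≤ 1 → ‖f x‖ ≤ M) →
    (∀ x₁ x₂ : X, ‖f (x₁ + x₂) - f x₁ - f x₂‖ ≤ ‖x₁‖ + ‖x₂‖) →
    ∃ g : X →L[𝕜] 𝕜, ∀ x : X, ‖f x - g x‖ ≤ κ * ‖x‖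

/-- `X` is a `𝒦₀`-space. -/
def IsK0Space (𝕜 : Type w) [RCLike 𝕜] (X : Type u) [NormedAddCommGroup X] [NormedSpace 𝕜 X] :
    Prop :=
  ∃ κ : ℝ, 0 ≤ κ ∧ IsK0Constant 𝕜 X κ

/-- The best constant `κ₀(X)` of a `𝒦₀`-space. -/
noncomputable def kappa0 (𝕜 : Type w) [RCLike 𝕜] (X : Type u) [NormedAddCommGroup X]
    [NormedSpace 𝕜 X] : ℝ :=
  sInf {κ : ℝ | 0 ≤ κ ∧ IsK0Constant 𝕜 X κ}

end BanachDist

/-! ### Gluing two spaces along a homogeneous map. -/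

namespace BanachDist

/-! Both parts reduce to one criterion (`IsK0Constant.kadetsDist_le`): a homogeneous map `φ : X → Y`
that is almost additive, almost norm-preserving and almost onto forces `d_K(X, Y)` to be small when
`X` is a `𝒦₀`-space. The `𝒦₀` property turns almost additivity for two summands into almost
additivity for any number of them, with an error linear in the sum of the norms and independent of
that number (`IsK0Constant.norm_map_sum_sub_le`). This is what is needed to put a seminorm on `X ×
Y` that leaves both norms intact and makes `x` and `φ x` close (`exists_common_banach`).

For (1), `φ` is a homogeneous choice of near points inside the `r`-normed space. Its defects are
sums of two or three small vectors, so only constants depending on `r` are lost. Error terms without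
a factor `κ` are absorbed by `1 / 6 ≤ κ`, which is where dimension at least 2 enters.

For (2), a small Gromov-Hausdorff distance gives a correspondence of the balls with small
distortion. A quantitative reflection argument in the style of Mazur-Ulam (`norm_sub_midpoint_le`)
shows that it almost preserves midpoints, so a selection from it is almost additive near the origin,
and therefore almost real-homogeneous. Replacing it by an exactly homogeneous map nearby puts the
criterion in force. -/

/-- The infimal convolution of the `ℓ₁`-norm of `X × Y` with the gauge generated by the vectors
`(x, -φ x)`, each given the weight `ε * ‖x‖`. -/
noncomputable def glueFun {X : Type u} [NormedAddCommGroup X] {Y : Type v} [NormedAddCommGroup Y]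
    (φ : X → Y) (ε : ℝ) (z : X × Y) (m : Multiset X) : ℝ :=
  ‖z.1 - m.sum‖ + ‖z.2 + (m.map φ).sum‖ + ε * (m.map norm).sum

theorem sum_map_norm_nonneg {X : Type u} [NormedAddCommGroup X] (m : Multiset X) :
    0 ≤ (m.map norm).sum :=
  Multiset.sum_nonneg fun x hx => by
    obtain ⟨a, -, rfl⟩ := Multiset.mem_map.1 hx
    exact norm_nonneg a

theorem norm_sum_le_sum_map_norm {X : Type u} [NormedAddCommGroup X] (m : Multiset X) :
    ‖m.sum‖ ≤ (m.map norm).sum := by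
  induction m using Multiset.induction_on with
  | empty => simp
  | cons a s ih =>
    simp only [Multiset.sum_cons, Multiset.map_cons]
    exact (norm_add_le _ _).trans (by gcongr)

section Glue

variable {𝕜 : Type w} [RCLike 𝕜]
  {X : Type u} [NormedAddCommGroup X] [NormedSpace 𝕜 X]
  {Y : Type v} [NormedAddCommGroup Y] [NormedSpace 𝕜 Y]

theorem glueFun_nonneg (φ : X → Y) {ε : ℝ} (hε : 0 ≤ ε) (z : X × Y) (m : Multiset X) :
    0 ≤ glueFun φ ε z m := by
  have := sum_map_norm_nonneg m
  unfold glueFun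
  positivity

theorem bddBelow_glueFun (φ : X → Y) {ε : ℝ} (hε : 0 ≤ ε) (z : X × Y) :
    BddBelow (Set.range (glueFun φ ε z)) :=
  ⟨0, by rintro _ ⟨m, rfl⟩; exact glueFun_nonneg φ hε z m⟩

/-- The seminorm on `X × Y` in which `X` and `Y` are glued along the map `φ`. -/
noncomputable def glueSeminorm (φ : X → Y) (hφ : ∀ (a : 𝕜) (x : X), φ (a • x) = a • φ x) {ε : ℝ}
    (hε : 0 ≤ ε) : Seminorm 𝕜 (X × Y) :=
  Seminorm.ofSMulLE (fun z => ⨅ m, glueFun φ ε z m)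
    (by
      refine le_antisymm ((ciInf_le (bddBelow_glueFun φ hε _) 0).trans (by simp [glueFun]))
        (le_ciInf fun m => glueFun_nonneg φ hε _ m))
    (by
      intro z z'
      refine le_ciInf_add_ciInf fun m m' => ?_
      refine (ciInf_le (bddBelow_glueFun φ hε _) (m + m')).trans ?_
      have h1 : ‖(z + z').1 - (m + m').sum‖ ≤ ‖z.1 - m.sum‖ + ‖z'.1 - m'.sum‖ := by
        rw [Multiset.sum_add, Prod.fst_add, add_sub_add_comm]
        exact norm_add_le _ _
      have h2 : ‖(z + z').2 + ((m + m').map φ).sum‖ ≤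
          ‖z.2 + (m.map φ).sum‖ + ‖z'.2 + (m'.map φ).sum‖ := by
        rw [Multiset.map_add, Multiset.sum_add, Prod.snd_add, add_add_add_comm]
        exact norm_add_le _ _
      have h3 : ((m + m').map norm).sum = (m.map norm).sum + (m'.map norm).sum := by
        rw [Multiset.map_add, Multiset.sum_add]
      unfold glueFun
      rw [h3]
      linarith)
    (by
      intro a z
      rw [Real.mul_iInf_of_nonneg (norm_nonneg a)]
      refine le_ciInf fun m => ?_
      -- Scaling a competitor for `z` gives one for `a • z`; this is where homogeneity of `φ` is
      -- used.
      refine (ciInf_le (bddBelow_glueFun φ hε _) (m.map fun x => a • x)).trans ?_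
      have h1 : (m.map fun x => a • x).sum = a • m.sum := (Multiset.smul_sum (r := a) (s := m)).symm
      have h2 : ((m.map fun x => a • x).map φ).sum = a • (m.map φ).sum := by
        rw [Multiset.map_map, Multiset.smul_sum, Multiset.map_map]
        simp [hφ]
      have h3 : ((m.map fun x => a • x).map norm).sum = ‖a‖ * (m.map norm).sum := by
        rw [Multiset.map_map, ← Multiset.sum_map_mul_left]
        simp [norm_smul]
      unfold glueFun
      rw [h1, h2, h3, Prod.smul_fst, Prod.smul_snd, ← smul_sub, ← smul_add, norm_smul, norm_smul]
      linarith)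

theorem glueSeminorm_apply (φ : X → Y) (hφ : ∀ (a : 𝕜) (x : X), φ (a • x) = a • φ x) {ε : ℝ}
    (hε : 0 ≤ ε) (z : X × Y) : glueSeminorm φ hφ hε z = ⨅ m, glueFun φ ε z m := rfl

/-- The completion is Hausdorff, so it also collapses the kernel of `p`. -/
theorem exists_banach_of_seminorm {E : Type u} [AddCommGroup E] [Module 𝕜 E] (p : Seminorm 𝕜 E) :
    ∃ (Z : Type u) (_ : NormedAddCommGroup Z) (_ : NormedSpace 𝕜 Z) (_ : CompleteSpace Z)
      (J : E →ₗ[𝕜] Z), ∀ e, ‖J e‖ = p e := by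
  let : SeminormedAddCommGroup E := p.toAddGroupSeminorm.toSeminormedAddCommGroup
  let : NormedSpace 𝕜 E := { norm_smul_le := fun a b => (map_smul_eq_mul p a b).le }
  exact ⟨UniformSpace.Completion E, inferInstance, inferInstance, inferInstance,
    (UniformSpace.Completion.toComplₗᵢ (𝕜 := 𝕜) (E := E)).toLinearMap,
    fun e => UniformSpace.Completion.norm_coe e⟩

/-- A homogeneous map which nearly preserves the norms of all finite sums of vectors can be
realized as a small displacement inside a common Banach space. -/
theorem exists_common_banach (φ : X → Y) (hφ : ∀ (a : 𝕜) (x : X), φ (a • x) = a • φ x) {ε : ℝ}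
    (hε : 0 ≤ ε)
    (h : ∀ m : Multiset X, |‖(m.map φ).sum‖ - ‖m.sum‖| ≤ ε * (m.map norm).sum) :
    ∃ (Z : Type (max u v)) (_ : NormedAddCommGroup Z) (_ : NormedSpace 𝕜 Z)
      (_ : CompleteSpace Z) (U : X →ₗᵢ[𝕜] Z) (V : Y →ₗᵢ[𝕜] Z),
      ∀ x, ‖U x - V (φ x)‖ ≤ ε * ‖x‖ := by
  obtain ⟨Z, _, _, _, J, hJ⟩ := exists_banach_of_seminorm (glueSeminorm φ hφ hε)
  refine ⟨Z, inferInstance, inferInstance, inferInstance,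
    ⟨J ∘ₗ LinearMap.inl 𝕜 X Y, fun x => ?_⟩, ⟨J ∘ₗ LinearMap.inr 𝕜 X Y, fun y => ?_⟩,
    fun x => ?_⟩
  · rw [LinearMap.comp_apply, hJ, glueSeminorm_apply]
    refine le_antisymm ((ciInf_le (bddBelow_glueFun φ hε _) 0).trans (by simp [glueFun]))
      (le_ciInf fun m => ?_)
    -- The `ε`-term pays for replacing `‖(m.map φ).sum‖` by `‖m.sum‖`; the triangle inequality in
    -- `X` then shows that no decomposition costs less than `‖x‖`.
    have h1 := (abs_le.1 (h m)).1
    have h2 := norm_sub_norm_le x m.sum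
    simp only [glueFun, LinearMap.inl_apply, zero_add]
    linarith
  · rw [LinearMap.comp_apply, hJ, glueSeminorm_apply]
    refine le_antisymm ((ciInf_le (bddBelow_glueFun φ hε _) 0).trans (by simp [glueFun]))
      (le_ciInf fun m => ?_)
    have h1 := (abs_le.1 (h m)).2
    have h2 := norm_sub_le (y + (m.map φ).sum) (m.map φ).sum
    simp only [add_sub_cancel_right] at h2
    simp only [glueFun, LinearMap.inr_apply, zero_sub, norm_neg]
    linarith
  · change ‖J (LinearMap.inl 𝕜 X Y x) - J (LinearMap.inr 𝕜 X Y (φ x))‖ ≤ _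
    rw [← map_sub, hJ, glueSeminorm_apply]
    exact (ciInf_le (bddBelow_glueFun φ hε _) {x}).trans (by simp [glueFun])

theorem kadetsDist_le_of_common {X : Type u} [NormedAddCommGroup X] [NormedSpace 𝕜 X]
    {Y : Type v} [NormedAddCommGroup Y] [NormedSpace 𝕜 Y]
    {Z : Type (max u v)} [NormedAddCommGroup Z] [NormedSpace 𝕜 Z] [CompleteSpace Z]
    (U : X →ₗᵢ[𝕜] Z) (V : Y →ₗᵢ[𝕜] Z) {δ : ℝ} (hδ : 0 ≤ δ)
    (hU : ∀ x, ‖x‖ ≤ 1 → ∃ y, ‖y‖ ≤ 1 ∧ ‖U x - V y‖ ≤ δ)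
    (hV : ∀ y, ‖y‖ ≤ 1 → ∃ x, ‖x‖ ≤ 1 ∧ ‖U x - V y‖ ≤ δ) :
    kadetsDist 𝕜 X Y ≤ δ := by
  unfold kadetsDist
  refine le_trans (csInf_le ⟨0, ?_⟩ ⟨Z, inferInstance, inferInstance, inferInstance, U, V, rfl⟩)
    (Metric.hausdorffDist_le_of_mem_dist hδ ?_ ?_)
  · rintro _ ⟨_, _, _, _, _, _, rfl⟩
    exact Metric.hausdorffDist_nonneg
  · rintro _ ⟨x, hx, rfl⟩
    obtain ⟨y, hy, h⟩ := hU x (by simpa using hx)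
    exact ⟨V y, ⟨y, by simpa using hy, rfl⟩, by rwa [dist_eq_norm]⟩
  · rintro _ ⟨y, hy, rfl⟩
    obtain ⟨x, hx, h⟩ := hV y (by simpa using hy)
    exact ⟨U x, ⟨x, by simpa using hx, rfl⟩, by rwa [dist_comm, dist_eq_norm]⟩

theorem kadetsDist_comm (𝕜 : Type w) [RCLike 𝕜]
    (X : Type u) [NormedAddCommGroup X] [NormedSpace 𝕜 X]
    (Y : Type v) [NormedAddCommGroup Y] [NormedSpace 𝕜 Y] :
    kadetsDist 𝕜 X Y = kadetsDist 𝕜 Y X := by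
  unfold kadetsDist
  congr 1
  ext δ
  constructor
  · rintro ⟨Z, _, _, _, U, V, rfl⟩
    exact ⟨Z, inferInstance, inferInstance, inferInstance, V, U, Metric.hausdorffDist_comm⟩
  · rintro ⟨Z, _, _, _, U, V, rfl⟩
    exact ⟨Z, inferInstance, inferInstance, inferInstance, V, U, Metric.hausdorffDist_comm⟩

theorem kadetsDist_nonneg (𝕜 : Type w) [RCLike 𝕜]
    (X : Type u) [NormedAddCommGroup X] [NormedSpace 𝕜 X]
    (Y : Type v) [NormedAddCommGroup Y] [NormedSpace 𝕜 Y] : 0 ≤ kadetsDist 𝕜 X Y :=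
  Real.sInf_nonneg (by
    rintro _ ⟨_, _, _, _, _, _, rfl⟩
    exact Metric.hausdorffDist_nonneg)

/-- Compose `φ` with a functional `g` norming the defect. The `𝒦₀` property puts `g ∘ φ` within `κ *
L * ‖x‖` of a linear functional, which is exactly additive. So `g (φ m.sum)` and the sum of the `g
(φ x)` are each within `κ * L * (m.map norm).sum` of the same number, whence the factor 2. -/
theorem IsK0Constant.norm_map_sum_sub_le {κ : ℝ} (hκ : IsK0Constant 𝕜 X κ) (hκ0 : 0 ≤ κ)
    (φ : X → Y) (hφ : ∀ (a : 𝕜) (x : X), φ (a • x) = a • φ x) {M : ℝ}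
    (hM : ∀ x, ‖φ x‖ ≤ M * ‖x‖) {L : ℝ} (hL : 0 < L)
    (hadd : ∀ x₁ x₂, ‖φ (x₁ + x₂) - φ x₁ - φ x₂‖ ≤ L * (‖x₁‖ + ‖x₂‖)) (m : Multiset X) :
    ‖φ m.sum - (m.map φ).sum‖ ≤ 2 * κ * L * (m.map norm).sum := by
  obtain ⟨g, hg, hgv⟩ := exists_dual_vector'' 𝕜 (φ m.sum - (m.map φ).sum)
  have hgle : ∀ y, ‖g y‖ ≤ ‖y‖ := fun y =>
    (g.le_opNorm y).trans (mul_le_of_le_one_left (norm_nonneg _) hg)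
  have hLne : (L : 𝕜) ≠ 0 := by exact_mod_cast hL.ne'
  have hLn : ‖(L : 𝕜)⁻¹‖ = L⁻¹ := by rw [norm_inv, RCLike.norm_ofReal, abs_of_pos hL]
  obtain ⟨x', hx'⟩ := hκ (fun x => (L : 𝕜)⁻¹ * g (φ x))
    (fun a x => by rw [hφ, map_smul, smul_eq_mul]; ring)
    ⟨L⁻¹ * |M|, fun x hx => by
      rw [norm_mul, hLn]
      refine mul_le_mul_of_nonneg_left ?_ (inv_nonneg.2 hL.le)
      refine (hgle _).trans ((hM x).trans ?_)
      calc M * ‖x‖ ≤ |M| * ‖x‖ := by gcongr; exact le_abs_self M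
        _ ≤ |M| * 1 := by gcongr
        _ = |M| := mul_one _⟩
    (fun x₁ x₂ => by
      rw [← mul_sub, ← mul_sub, ← map_sub, ← map_sub, norm_mul, hLn,
        inv_mul_le_iff₀ hL]
      exact (hgle _).trans (hadd x₁ x₂))
  have key : ∀ x, ‖g (φ x) - L * x' x‖ ≤ κ * L * ‖x‖ := fun x => by
    have h := mul_le_mul_of_nonneg_left (hx' x) hL.le
    have h2 : L * ‖(L : 𝕜)⁻¹ * g (φ x) - x' x‖ = ‖g (φ x) - L * x' x‖ := by
      have hLL : L = ‖(L : 𝕜)‖ := by rw [RCLike.norm_ofReal, abs_of_pos hL]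
      nth_rw 1 [hLL]
      rw [← norm_mul, mul_sub, mul_inv_cancel_left₀ hLne]
    rw [h2] at h
    linarith
  have hsum : ∀ s : Multiset X,
      ‖g (s.map φ).sum - L * x' s.sum‖ ≤ κ * L * (s.map norm).sum := fun s => by
    induction s using Multiset.induction_on with
    | empty => simp
    | cons a s ih =>
      simp only [Multiset.map_cons, Multiset.sum_cons, map_add]
      have h1 := key a
      have h2 : g (φ a) + g (s.map φ).sum - L * (x' a + x' s.sum) =
          (g (φ a) - L * x' a) + (g (s.map φ).sum - L * x' s.sum) := by ring
      rw [h2]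
      exact (norm_add_le _ _).trans (by linarith)
  have hnorm : ‖φ m.sum - (m.map φ).sum‖ = ‖g (φ m.sum - (m.map φ).sum)‖ := by
    rw [hgv, RCLike.norm_ofReal, abs_of_nonneg (norm_nonneg _)]
  rw [hnorm, map_sub]
  have h2 : g (φ m.sum) - g (m.map φ).sum =
      (g (φ m.sum) - L * x' m.sum) - (g (m.map φ).sum - L * x' m.sum) := by ring
  rw [h2]
  have h3 : κ * L * ‖m.sum‖ ≤ κ * L * (m.map norm).sum := by
    gcongr
    exact norm_sum_le_sum_map_norm m
  refine (norm_sub_le _ _).trans ?_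
  linarith [key m.sum, hsum m]

/-- A nearly additive, nearly isometric, nearly surjective homogeneous map from a `𝒦₀`-space
bounds the Kadets distance. -/
theorem IsK0Constant.kadetsDist_le {κ : ℝ} (hκ : IsK0Constant 𝕜 X κ) (hκ0 : 0 ≤ κ)
    (φ : X → Y) (hφ : ∀ (a : 𝕜) (x : X), φ (a • x) = a • φ x) {L ε₁ ε₂ ε₃ : ℝ} (hL : 0 < L)
    (h₁ : 0 ≤ ε₁) (h₂ : 0 ≤ ε₂) (h₃ : 0 ≤ ε₃)
    (hadd : ∀ x₁ x₂, ‖φ (x₁ + x₂) - φ x₁ - φ x₂‖ ≤ L * (‖x₁‖ + ‖x₂‖))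
    (hnorm : ∀ x, |‖φ x‖ - ‖x‖| ≤ ε₁ * ‖x‖)
    (hsurj : ∀ y, ∃ x, ‖x‖ ≤ (1 + ε₃) * ‖y‖ ∧ ‖φ x - y‖ ≤ ε₂ * ‖y‖) :
    kadetsDist 𝕜 X Y ≤ (2 * κ * L + ε₁) * (1 + ε₃) + ε₁ + ε₂ + ε₃ := by
  have hM : ∀ x, ‖φ x‖ ≤ (1 + ε₁) * ‖x‖ := fun x => by
    have := (abs_le.1 (hnorm x)).2
    linarith
  obtain ⟨Z, _, _, _, U, V, hUV⟩ := exists_common_banach φ hφ (ε := 2 * κ * L + ε₁)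
    (by positivity) (fun m => by
      have h1 := hκ.norm_map_sum_sub_le hκ0 φ hφ hM hL hadd m
      have h2 := hnorm m.sum
      have h3 : ε₁ * ‖m.sum‖ ≤ ε₁ * (m.map norm).sum := by
        gcongr
        exact norm_sum_le_sum_map_norm m
      have h4 := abs_norm_sub_norm_le (φ m.sum) (m.map φ).sum
      rw [abs_le] at *
      constructor <;> linarith)
  have hε : 0 ≤ 2 * κ * L + ε₁ := by positivity
  have hεε : 2 * κ * L + ε₁ ≤ (2 * κ * L + ε₁) * (1 + ε₃) :=
    le_mul_of_one_le_right hε (by linarith)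
  -- Images and preimages may leave the unit ball slightly; pulling a vector of norm at most `1 + c`
  -- back into the ball moves it by at most `c`.
  have shrink : ∀ (W : Type (max u v)) [NormedAddCommGroup W] [NormedSpace 𝕜 W] (v : W) (c : ℝ),
      0 ≤ c → ‖v‖ ≤ 1 + c → ‖((1 + c : ℝ) : 𝕜)⁻¹ • v‖ ≤ 1 ∧
        ‖((1 + c : ℝ) : 𝕜)⁻¹ • v - v‖ ≤ c := by
    intro W _ _ v c hc hv
    have hpos : 0 < 1 + c := by linarith
    have e : ((1 + c : ℝ) : 𝕜)⁻¹ • v - v = (((1 + c)⁻¹ - 1 : ℝ) : 𝕜) • v := by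
      rw [RCLike.ofReal_sub, RCLike.ofReal_inv, RCLike.ofReal_one, sub_smul, one_smul]
    have e2 : |(1 + c)⁻¹ - 1| = c * (1 + c)⁻¹ := by
      rw [abs_of_nonpos (by
        have := inv_le_one_of_one_le₀ (show 1 ≤ 1 + c by linarith)
        linarith)]
      field_simp
      ring
    constructor
    · rw [norm_smul, norm_inv, RCLike.norm_ofReal, abs_of_pos hpos, inv_mul_le_iff₀ hpos]
      linarith
    · rw [e, norm_smul, RCLike.norm_ofReal, e2, mul_assoc]
      refine mul_le_of_le_one_right hc ?_
      rw [inv_mul_le_iff₀ hpos]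
      linarith
  refine kadetsDist_le_of_common U V (by positivity) (fun x hx => ?_) (fun y hy => ?_)
  · have hφx : ‖V (φ x)‖ ≤ 1 + ε₁ := by
      rw [V.norm_map]
      exact (hM x).trans (mul_le_of_le_one_right (by positivity) hx)
    obtain ⟨ha, hb⟩ := shrink Z (V (φ x)) ε₁ h₁ hφx
    refine ⟨((1 + ε₁ : ℝ) : 𝕜)⁻¹ • φ x, ?_, ?_⟩
    · rwa [← V.norm_map, map_smul]
    · rw [map_smul]
      have h := norm_sub_le_norm_sub_add_norm_sub (U x) (V (φ x)) (((1 + ε₁ : ℝ) : 𝕜)⁻¹ • V (φ x))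
      rw [norm_sub_rev (V (φ x))] at h
      have h' := (hUV x).trans (mul_le_of_le_one_right hε hx)
      linarith
  · obtain ⟨x, hx, hxy⟩ := hsurj y
    have hx1 : ‖x‖ ≤ 1 + ε₃ := hx.trans (mul_le_of_le_one_right (by positivity) hy)
    obtain ⟨ha, hb⟩ := shrink Z (U x) ε₃ h₃ (by rwa [U.norm_map])
    refine ⟨((1 + ε₃ : ℝ) : 𝕜)⁻¹ • x, ?_, ?_⟩
    · rwa [← U.norm_map, map_smul]
    · rw [map_smul]
      have h1 := norm_sub_le_norm_sub_add_norm_sub (((1 + ε₃ : ℝ) : 𝕜)⁻¹ • U x) (U x) (V y)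
      have h2 := norm_sub_le_norm_sub_add_norm_sub (U x) (V (φ x)) (V y)
      have h3 : ‖V (φ x) - V y‖ ≤ ε₂ := by
        rw [← map_sub, V.norm_map]
        exact hxy.trans (mul_le_of_le_one_right h₂ hy)
      have h4 := (hUV x).trans (mul_le_mul_of_nonneg_left hx1 hε)
      linarith

end Glue

end BanachDist

/-! ### Homogeneous selections and the lower bound for the `𝒦₀` constant. -/

namespace BanachDist

/-- Every scaling-invariant relation with full domain contains the graph of a homogeneous map. -/
theorem exists_homogeneous_selection {𝕜 : Type w} [Field 𝕜] {X : Type u} [AddCommGroup X]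
    [Module 𝕜 X] {Y : Type v} [AddCommGroup Y] [Module 𝕜 Y] (P : X → Y → Prop)
    (hP : ∀ (a : 𝕜) x y, P x y → P (a • x) (a • y)) (hex : ∀ x, ∃ y, P x y) :
    ∃ φ : X → Y, (∀ (a : 𝕜) x, φ (a • x) = a • φ x) ∧ ∀ x, P x (φ x) := by
  choose F hF using hex
  -- Select a value at one representative of each orbit of the nonzero scalars and extend by
  -- scaling. This is consistent because nonzero vectors have trivial stabilizer.
  let rep : X → X := fun x => (Quotient.mk (MulAction.orbitRel 𝕜ˣ X) x).out
  have hrep : ∀ x, ∃ c : 𝕜ˣ, c • rep x = x := fun x => by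
    have h : (MulAction.orbitRel 𝕜ˣ X).r x (rep x) :=
      (MulAction.orbitRel 𝕜ˣ X).symm (Quotient.mk_out (s := MulAction.orbitRel 𝕜ˣ X) x)
    exact h
  choose c hc using hrep
  have hrep_smul : ∀ (a : 𝕜ˣ) x, rep (a • x) = rep x := fun a x => by
    have : Quotient.mk (MulAction.orbitRel 𝕜ˣ X) (a • x) = Quotient.mk _ x :=
      Quotient.sound ⟨a, rfl⟩
    simp only [rep, this]
  have hP0 : P 0 0 := by simpa using hP 0 _ _ (hF 0)
  classical
  refine ⟨fun x => if x = 0 then 0 else (c x : 𝕜) • F (rep x), fun a x => ?_, fun x => ?_⟩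
  · rcases eq_or_ne a 0 with rfl | ha
    · simp
    rcases eq_or_ne x 0 with rfl | hx
    · simp
    have hax : a • x ≠ 0 := smul_ne_zero ha hx
    have hr : rep (a • x) = rep x := hrep_smul (Units.mk0 a ha) x
    have hr0 : rep x ≠ 0 := fun h => hx (by rw [← hc x, h, smul_zero])
    have hcc : (c (a • x) : 𝕜) = a * c x := by
      refine smul_left_injective 𝕜 hr0 ?_
      have h1 := hc (a • x)
      rw [hr, Units.smul_def] at h1
      have h2 := hc x
      rw [Units.smul_def] at h2
      change (c (a • x) : 𝕜) • rep x = (a * c x) • rep x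
      rw [h1, mul_smul, h2]
    simp only [hx, hax, if_false, hr, hcc, mul_smul]
  · by_cases hx : x = 0
    · simpa [hx] using hP0
    · have h := hP (c x) _ _ (hF (rep x))
      have h2 := hc x
      rw [Units.smul_def] at h2
      rw [h2] at h
      simpa [hx] using h

/-- The obstruction is a function equal to half the norm at `w = x + y`, extended linearly to the
line through `w` and zero off that line. Being bounded by `‖v‖ / 2`, it has an admissible defect,
but a functional near it must be small at `x` and `y`, hence at `w`. -/
theorem IsK0Constant.one_sixth_le {𝕜 : Type w} [RCLike 𝕜] {X : Type u} [NormedAddCommGroup X]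
    [NormedSpace 𝕜 X] (hdim : 2 ≤ Module.rank 𝕜 X) {κ : ℝ} (hκ : IsK0Constant 𝕜 X κ) :
    1 / 6 ≤ κ := by
  obtain ⟨x, y, hx, hy, hlin, hxy⟩ : ∃ x y : X, ‖x‖ = 1 ∧ ‖y‖ = 1 ∧
      (∀ a b : 𝕜, a • x + b • y = 0 → a = 0 ∧ b = 0) ∧ 1 ≤ ‖x + y‖ := by
    obtain ⟨x, y, hli⟩ : ∃ x y : X, LinearIndependent 𝕜 ![x, y] := by
      have h : ((2 : ℕ) : Cardinal) ≤ Module.rank 𝕜 X := by exact_mod_cast hdim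
      obtain ⟨f, hf⟩ := (Module.le_rank_iff (R := 𝕜) (M := X)).1 h
      refine ⟨f 0, f 1, ?_⟩
      convert hf using 1
      ext i
      fin_cases i <;> rfl
    rw [LinearIndependent.pair_iff] at hli
    have hx : x ≠ 0 := fun h => one_ne_zero (hli 1 0 (by simp [h])).1
    have hy : y ≠ 0 := fun h => one_ne_zero (hli 0 1 (by simp [h])).2
    have hx' : ((‖x‖ : 𝕜)⁻¹) ≠ 0 := by simpa using hx
    have hy' : ((‖y‖ : 𝕜)⁻¹) ≠ 0 := by simpa using hy
    have hnx : ‖((‖x‖ : 𝕜)⁻¹) • x‖ = 1 := norm_smul_inv_norm hx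
    have hny : ‖((‖y‖ : 𝕜)⁻¹) • y‖ = 1 := norm_smul_inv_norm hy
    set p := ((‖x‖ : 𝕜)⁻¹) • x with hp
    set q := ((‖y‖ : 𝕜)⁻¹) • y with hq
    have hpq : ∀ a b : 𝕜, a • p + b • q = 0 → a = 0 ∧ b = 0 := fun a b h => by
      rw [hp, hq, smul_smul, smul_smul] at h
      obtain ⟨h1, h2⟩ := hli _ _ h
      exact ⟨(mul_eq_zero.1 h1).resolve_right hx', (mul_eq_zero.1 h2).resolve_right hy'⟩
    -- The sum of `p + q` and `p - q` is `2p`, of norm 2, so one of them has norm at least 1.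
    rcases le_total 1 ‖p + q‖ with h | h
    · exact ⟨p, q, hnx, hny, hpq, h⟩
    · refine ⟨p, -q, hnx, by rwa [norm_neg], fun a b hab => ?_, ?_⟩
      · obtain ⟨h1, h2⟩ := hpq a (-b) (by simpa using hab)
        exact ⟨h1, by simpa using h2⟩
      · have h3 : ‖(p + q) + (p + -q)‖ ≤ ‖p + q‖ + ‖p + -q‖ := norm_add_le _ _
        have h4 : (p + q) + (p + -q) = (2 : 𝕜) • p := by rw [two_smul]; abel
        rw [h4, norm_smul, hnx, RCLike.norm_two] at h3
        linarith
  have hw0 : x + y ≠ 0 := fun h => by simp [h] at hxy; linarith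
  set w := x + y with hw
  obtain ⟨f, hf, hfP⟩ := exists_homogeneous_selection (𝕜 := 𝕜) (X := X) (Y := 𝕜)
    (fun v t => ‖t‖ ≤ ‖v‖ / 2 ∧ (∀ a : 𝕜, v = a • w → t = a * (‖w‖ / 2 : ℝ)) ∧
      ((∀ a : 𝕜, v ≠ a • w) → t = 0))
    (by
      rintro a v t ⟨h1, h2, h3⟩
      rcases eq_or_ne a 0 with rfl | ha
      · refine ⟨by simp, fun b hb => ?_, fun _ => by simp⟩
        rw [zero_smul, eq_comm, smul_eq_zero] at hb
        simp [hb.resolve_right hw0]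
      refine ⟨?_, fun b hb => ?_, fun h => ?_⟩
      · rw [norm_smul, norm_smul, mul_div_assoc]
        gcongr
      · rw [h2 (a⁻¹ * b) (by rw [mul_smul, ← hb, inv_smul_smul₀ ha]), smul_eq_mul]
        field_simp
      · rw [h3 fun b hb => h (a * b) (by rw [hb, mul_smul]), smul_zero])
    (by
      intro v
      by_cases hv : ∃ a : 𝕜, v = a • w
      · obtain ⟨a, rfl⟩ := hv
        refine ⟨a * (‖w‖ / 2 : ℝ), ?_, fun b hb => ?_, fun h => absurd rfl (h a)⟩
        · rw [norm_mul, norm_smul, RCLike.norm_ofReal, abs_of_nonneg (by positivity)]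
          exact le_of_eq (by ring)
        · rw [smul_left_injective 𝕜 hw0 hb]
      · push Not at hv
        exact ⟨0, by rw [norm_zero]; positivity, fun a ha => absurd ha (hv a), fun _ => rfl⟩)
  have hfx : f x = 0 := (hfP x).2.2 fun a ha => by
    have := hlin (1 - a) (-a) (by rw [sub_smul, one_smul, neg_smul]; nth_rw 1 [ha]; rw [hw, smul_add]; abel)
    obtain ⟨h1, h2⟩ := this
    have : a = 0 := by simpa using h2
    simp [this] at h1
  have hfy : f y = 0 := (hfP y).2.2 fun a ha => by
    have := hlin (-a) (1 - a) (by rw [sub_smul, one_smul, neg_smul]; nth_rw 1 [ha]; rw [hw, smul_add]; abel)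
    obtain ⟨h1, h2⟩ := this
    have : a = 0 := by simpa using h1
    simp [this] at h2
  have hfw : f w = (‖w‖ / 2 : ℝ) := by simpa using (hfP w).2.1 1 (by simp)
  obtain ⟨g, hg⟩ := hκ f (fun a v => hf a v) ⟨1, fun v hv => (hfP v).1.trans (by linarith)⟩
    (fun v₁ v₂ => by
      have h1 := (hfP v₁).1
      have h2 := (hfP v₂).1
      have h3 := (hfP (v₁ + v₂)).1
      have h4 := norm_add_le v₁ v₂
      have h5 := norm_sub_le (f (v₁ + v₂) - f v₁) (f v₂)
      have h6 := norm_sub_le (f (v₁ + v₂)) (f v₁)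
      linarith)
  have h1 := hg x
  have h2 := hg y
  have h3 := hg w
  rw [hfx, zero_sub, norm_neg, hx, mul_one] at h1
  rw [hfy, zero_sub, norm_neg, hy, mul_one] at h2
  have h4 : ‖f w‖ ≤ ‖f w - g w‖ + ‖g w‖ := by simpa using norm_add_le (f w - g w) (g w)
  have h5 : ‖g w‖ ≤ ‖g x‖ + ‖g y‖ := by rw [hw, map_add]; exact norm_add_le _ _
  rw [show ‖f w‖ = ‖w‖ / 2 by rw [hfw, RCLike.norm_ofReal, abs_of_nonneg (by positivity)]] at h4
  -- The estimates give `‖w‖ / 2 ≤ κ * (‖w‖ + 2)`, which is at most `3 * κ * ‖w‖` since `1 ≤ ‖w‖`.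
  nlinarith [(norm_nonneg _).trans h1]

theorem IsK0Space.one_sixth_le_kappa0 {𝕜 : Type w} [RCLike 𝕜] {X : Type u} [NormedAddCommGroup X]
    [NormedSpace 𝕜 X] (hX : IsK0Space 𝕜 X) (hdim : 2 ≤ Module.rank 𝕜 X) :
    1 / 6 ≤ kappa0 𝕜 X := by
  obtain ⟨κ, hκ⟩ := hX
  exact le_csInf ⟨κ, hκ⟩ fun κ' hκ' => hκ'.2.one_sixth_le hdim

/-! ### Calculus of `r`-norms. -/

section RNorm

variable {𝕜 : Type w} [RCLike 𝕜] {Z : Type u} [AddCommGroup Z] [Module 𝕜 Z] {r : ℝ} {N : Z → ℝ}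

theorem IsRNorm.map_zero (hN : IsRNorm 𝕜 r N) : N 0 = 0 := by
  simpa using hN.smul 0 0

theorem IsRNorm.map_neg (hN : IsRNorm 𝕜 r N) (z : Z) : N (-z) = N z := by
  simpa using hN.smul (-1) z

theorem IsRNorm.nonneg (hN : IsRNorm 𝕜 r N) (z : Z) : 0 ≤ N z := by
  rcases eq_or_ne z 0 with rfl | hz
  · exact hN.map_zero.ge
  · exact (hN.pos z hz).le

theorem IsRNorm.map_sub_comm (hN : IsRNorm 𝕜 r N) (z z' : Z) : N (z - z') = N (z' - z) := by
  rw [← hN.map_neg, neg_sub]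

/-- The constant `2 ^ (1 / r)` in the quasi-triangle inequality. -/
theorem IsRNorm.add_le (hN : IsRNorm 𝕜 r N) (hr : 0 < r) {z₁ z₂ : Z} {t : ℝ} (h₁ : N z₁ ≤ t)
    (h₂ : N z₂ ≤ t) : N (z₁ + z₂) ≤ 2 ^ (1 / r) * t := by
  have ht : 0 ≤ t := (hN.nonneg _).trans h₁
  rw [← Real.rpow_le_rpow_iff (hN.nonneg _) (by positivity) hr,
    Real.mul_rpow (by positivity) ht, ← Real.rpow_mul (by norm_num), one_div_mul_cancel hr.ne',
    Real.rpow_one]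
  have e₁ := Real.rpow_le_rpow (hN.nonneg _) h₁ hr.le
  have e₂ := Real.rpow_le_rpow (hN.nonneg _) h₂ hr.le
  linarith [hN.add_rpow_le z₁ z₂]

theorem IsRNorm.add_add_le (hN : IsRNorm 𝕜 r N) (hr : 0 < r) {z₁ z₂ z₃ : Z} {t : ℝ}
    (h₁ : N z₁ ≤ t) (h₂ : N z₂ ≤ t) (h₃ : N z₃ ≤ t) : N (z₁ + z₂ + z₃) ≤ 3 ^ (1 / r) * t := by
  have ht : 0 ≤ t := (hN.nonneg _).trans h₁
  rw [← Real.rpow_le_rpow_iff (hN.nonneg _) (by positivity) hr,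
    Real.mul_rpow (by positivity) ht, ← Real.rpow_mul (by norm_num), one_div_mul_cancel hr.ne',
    Real.rpow_one]
  have e₁ := Real.rpow_le_rpow (hN.nonneg _) h₁ hr.le
  have e₂ := Real.rpow_le_rpow (hN.nonneg _) h₂ hr.le
  have e₃ := Real.rpow_le_rpow (hN.nonneg _) h₃ hr.le
  linarith [hN.add_rpow_le z₁ z₂, hN.add_rpow_le (z₁ + z₂) z₃]

theorem IsRNorm.bounded (hN : IsRNorm 𝕜 r N) (hr : 0 < r) {A B : Set Z} (hA : ∀ a ∈ A, N a ≤ 1)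
    (hB : ∀ b ∈ B, N b ≤ 1) {a b : Z} (ha : a ∈ A) (hb : b ∈ B) :
    N (a - b) ≤ 2 ^ (1 / r) := by
  rw [sub_eq_add_neg]
  simpa using hN.add_le hr (hA a ha) ((hN.map_neg b).le.trans (hB b hb))

theorem IsRNorm.exists_of_gaugeHausdorffDist_lt (hN : IsRNorm 𝕜 r N) (hr : 0 < r) {A B : Set Z}
    (hA : ∀ a ∈ A, N a ≤ 1) (hB : ∀ b ∈ B, N b ≤ 1) (hA' : A.Nonempty) (hB' : B.Nonempty)
    {δ : ℝ} (hδ : gaugeHausdorffDist N A B < δ) :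
    (∀ a ∈ A, ∃ b ∈ B, N (a - b) < δ) ∧ (∀ b ∈ B, ∃ a ∈ A, N (a - b) < δ) := by
  have : Nonempty A := hA'.to_subtype
  have : Nonempty B := hB'.to_subtype
  have h := max_lt_iff.1 hδ
  have b1 : ∀ a : A, BddBelow (Set.range fun b : B => N ((a : Z) - b)) := fun a =>
    ⟨0, by rintro _ ⟨b, rfl⟩; exact hN.nonneg _⟩
  have b2 : ∀ b : B, BddBelow (Set.range fun a : A => N ((a : Z) - b)) := fun b =>
    ⟨0, by rintro _ ⟨a, rfl⟩; exact hN.nonneg _⟩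
  constructor
  · intro a ha
    have h1 : (⨅ b : B, N (a - b)) < δ := by
      -- A real supremum over an unbounded family is 0 by convention, so the bound `2 ^ (1 / r)` is
      -- needed before the supremum says anything.
      refine (le_ciSup (f := fun a : A => ⨅ b : B, N ((a : Z) - b)) ⟨2 ^ (1 / r), ?_⟩ ⟨a, ha⟩).trans_lt h.1
      rintro _ ⟨a, rfl⟩
      exact (ciInf_le (b1 a) (Classical.arbitrary B)).trans
        (hN.bounded hr hA hB a.2 (Classical.arbitrary B).2)
    obtain ⟨b, hb⟩ := exists_lt_of_ciInf_lt h1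
    exact ⟨b, b.2, hb⟩
  · intro b hb
    have h1 : (⨅ a : A, N (a - b)) < δ := by
      refine (le_ciSup (f := fun b : B => ⨅ a : A, N ((a : Z) - b)) ⟨2 ^ (1 / r), ?_⟩ ⟨b, hb⟩).trans_lt h.2
      rintro _ ⟨b, rfl⟩
      exact (ciInf_le (b2 b) (Classical.arbitrary A)).trans
        (hN.bounded hr hA hB (Classical.arbitrary A).2 b.2)
    obtain ⟨a, ha⟩ := exists_lt_of_ciInf_lt h1
    exact ⟨a, a.2, ha⟩

theorem gaugeHausdorffDist_nonneg (hN : IsRNorm 𝕜 r N) (A B : Set Z) :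
    0 ≤ gaugeHausdorffDist N A B :=
  le_max_of_le_left (Real.iSup_nonneg fun _ => Real.iInf_nonneg fun _ => hN.nonneg _)

end RNorm

/-! ### Comparison of the Kadets distance with `d_r`. -/

section RDist

variable {𝕜 : Type w} [RCLike 𝕜]
  {X : Type u} [NormedAddCommGroup X] [NormedSpace 𝕜 X]
  {Y : Type v} [NormedAddCommGroup Y] [NormedSpace 𝕜 Y]

/-- The set defining `rDist` is nonempty: the `ℓ₁`-sum of `X` and `Y` is a competitor. -/
theorem rDist_set_nonempty [CompleteSpace X] [CompleteSpace Y] {r : ℝ} (hr : 0 < r) (hr1 : r < 1) :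
    {δ : ℝ | ∃ (Z : Type (max u v)) (_ : AddCommGroup Z) (_ : Module 𝕜 Z) (N : Z → ℝ)
      (U : X →ₗ[𝕜] Z) (V : Y →ₗ[𝕜] Z),
      IsRNorm 𝕜 r N ∧ IsRComplete r N ∧ (∀ x, N (U x) = ‖x‖) ∧ (∀ y, N (V y) = ‖y‖) ∧
      δ = gaugeHausdorffDist N (U '' Metric.closedBall 0 1) (V '' Metric.closedBall 0 1)}.Nonempty := by
  refine ⟨_, X × Y, inferInstance, inferInstance, norm, LinearMap.inl 𝕜 X Y, LinearMap.inr 𝕜 X Y,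
    ⟨fun z hz => norm_pos_iff.2 hz, norm_smul, fun z₁ z₂ => ?_⟩, fun s hs => ?_, fun x => by simp,
    fun y => by simp, rfl⟩
  -- The product carries the max norm; any norm is an `r`-norm because `t ↦ t ^ r` is subadditive
  -- for `r ≤ 1`.
  · exact (Real.rpow_le_rpow (norm_nonneg _) (norm_add_le _ _) hr.le).trans
      (Real.rpow_add_le_add_rpow (norm_nonneg _) (norm_nonneg _) hr.le hr1.le)
  · have hc : CauchySeq s := by
      refine Metric.cauchySeq_iff.2 fun ε hε => ?_
      obtain ⟨n₀, h⟩ := hs (ε ^ r) (by positivity)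
      refine ⟨n₀, fun m hm n hn => ?_⟩
      rw [dist_eq_norm]
      exact (Real.rpow_lt_rpow_iff (norm_nonneg _) hε.le hr).1 (h m hm n hn)
    obtain ⟨z, hz⟩ := cauchySeq_tendsto_of_complete hc
    refine ⟨z, ?_⟩
    have h := (tendsto_iff_norm_sub_tendsto_zero.1 hz).rpow_const (p := r) (Or.inr hr.le)
    rwa [Real.zero_rpow hr.ne'] at h

/-- Approximation of points of one unit ball by points of the other extends by homogeneity. -/
theorem exists_approx_of_ball {Z : Type*} [AddCommGroup Z] [Module 𝕜 Z] {r : ℝ} {N : Z → ℝ}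
    (hN : IsRNorm 𝕜 r N) (U : X →ₗ[𝕜] Z) (V : Y →ₗ[𝕜] Z) {δ : ℝ}
    (h : ∀ x, ‖x‖ ≤ 1 → ∃ y, ‖y‖ ≤ 1 ∧ N (U x - V y) ≤ δ) (x : X) :
    ∃ y, ‖y‖ ≤ ‖x‖ ∧ N (U x - V y) ≤ δ * ‖x‖ := by
  rcases eq_or_ne x 0 with rfl | hx
  · exact ⟨0, by simp, by simp [hN.map_zero]⟩
  obtain ⟨y, hy, hxy⟩ := h ((‖x‖ : 𝕜)⁻¹ • x) (norm_smul_inv_norm hx).le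
  have hx0 : (‖x‖ : 𝕜) ≠ 0 := by simpa using hx
  refine ⟨(‖x‖ : 𝕜) • y, ?_, ?_⟩
  · rw [norm_smul, RCLike.norm_ofReal, abs_norm]
    exact mul_le_of_le_one_right (norm_nonneg _) hy
  · have e : U x - V ((‖x‖ : 𝕜) • y) = (‖x‖ : 𝕜) • (U ((‖x‖ : 𝕜)⁻¹ • x) - V y) := by
      rw [smul_sub, ← map_smul, ← map_smul, smul_inv_smul₀ hx0]
    rw [e, hN.smul, RCLike.norm_ofReal, abs_norm, mul_comm]
    gcongr

theorem IsK0Constant.kadetsDist_le_of_rNorm {κ : ℝ} (hκ : IsK0Constant 𝕜 X κ) (hκ6 : 1 / 6 ≤ κ)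
    {Z : Type*} [AddCommGroup Z] [Module 𝕜 Z] {r : ℝ} (hr : 0 < r) {N : Z → ℝ}
    (hN : IsRNorm 𝕜 r N) (U : X →ₗ[𝕜] Z) (V : Y →ₗ[𝕜] Z) (hU : ∀ x, N (U x) = ‖x‖)
    (hV : ∀ y, N (V y) = ‖y‖) {δ : ℝ} (hδ : 0 < δ)
    (h₁ : ∀ x, ‖x‖ ≤ 1 → ∃ y, ‖y‖ ≤ 1 ∧ N (U x - V y) ≤ δ)
    (h₂ : ∀ y, ‖y‖ ≤ 1 → ∃ x, ‖x‖ ≤ 1 ∧ N (U x - V y) ≤ δ) :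
    kadetsDist 𝕜 X Y ≤ 20 * 3 ^ (1 / r) * κ * δ := by
  have a₁ := exists_approx_of_ball hN U V h₁
  have a₂ := exists_approx_of_ball hN V U (fun y hy => by
    obtain ⟨x, hx, h⟩ := h₂ y hy
    exact ⟨x, hx, by rwa [hN.map_sub_comm]⟩)
  obtain ⟨φ, hφ, hφP⟩ := exists_homogeneous_selection (𝕜 := 𝕜)
    (fun (x : X) (y : Y) => ‖y‖ ≤ ‖x‖ ∧ N (U x - V y) ≤ δ * ‖x‖)
    (fun a x y ⟨hy, h⟩ => by
      refine ⟨by rw [norm_smul, norm_smul]; gcongr, ?_⟩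
      rw [map_smul, map_smul, ← smul_sub, hN.smul, norm_smul, mul_left_comm]
      gcongr) a₁
  have key := hκ.kadetsDist_le (by linarith) φ hφ (L := 3 ^ (1 / r) * δ) (ε₁ := 2 ^ (1 / r) * δ)
    (ε₂ := 2 ^ (1 / r) * δ) (ε₃ := 0) (by positivity) (by positivity) (by positivity) le_rfl
    (fun x₁ x₂ => by
      have b := norm_nonneg x₁
      have b' := norm_nonneg x₂
      -- The defect is a sum of three displacements, each of gauge at most `δ * (‖x₁‖ + ‖x₂‖)`;
      -- since it lies in the image of `V`, its gauge is a norm in `Y`.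
      have e : V (φ (x₁ + x₂) - φ x₁ - φ x₂) = (V (φ (x₁ + x₂)) - U (x₁ + x₂)) +
          (U x₁ - V (φ x₁)) + (U x₂ - V (φ x₂)) := by
        simp only [map_add, map_sub]
        abel
      rw [← hV, e, mul_assoc]
      refine hN.add_add_le hr ?_ ((hφP x₁).2.trans ?_) ((hφP x₂).2.trans ?_)
      · rw [hN.map_sub_comm]
        refine (hφP _).2.trans ?_
        gcongr
        exact norm_add_le _ _
      · gcongr
        linarith
      · gcongr
        linarith)
    (fun x => by
      -- The selection gives `‖φ x‖ ≤ ‖x‖`. For the converse, go back from `φ x` to some `x'` with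
      -- `‖x'‖ ≤ ‖φ x‖`; the difference `x - x'` is small because `U` preserves its norm.
      obtain ⟨x', hx', hN'⟩ := a₂ (φ x)
      have hle := (hφP x).1
      have e : U (x - x') = (U x - V (φ x)) + (V (φ x) - U x') := by
        rw [map_sub]
        abel
      have h3 : ‖x - x'‖ ≤ 2 ^ (1 / r) * (δ * ‖x‖) := by
        rw [← hU, e]
        refine hN.add_le hr (hφP x).2 (hN'.trans ?_)
        gcongr
      rw [abs_of_nonpos (by linarith), mul_assoc]
      linarith [norm_sub_norm_le x x'])
    (fun y => by
      obtain ⟨x, hx, hxy⟩ := a₂ y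
      refine ⟨x, by simpa using hx, ?_⟩
      have e : V (φ x - y) = (V (φ x) - U x) + (U x - V y) := by
        rw [map_sub]
        abel
      rw [← hV, e, mul_assoc]
      refine hN.add_le hr ?_ ?_
      · rw [hN.map_sub_comm]
        refine (hφP x).2.trans ?_
        gcongr
      · rwa [hN.map_sub_comm])
  refine key.trans ?_
  -- The total is at most `(2 * κ + 3) * 3 ^ (1 / r) * δ`, and `3 ≤ 18 * κ` yields the factor 20.
  have h23 : (2 : ℝ) ^ (1 / r) ≤ 3 ^ (1 / r) :=
    Real.rpow_le_rpow (by norm_num) (by norm_num) (by positivity)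
  have h3 : 0 < (3 : ℝ) ^ (1 / r) * δ := by positivity
  have h4 : (2 : ℝ) ^ (1 / r) * δ ≤ 3 ^ (1 / r) * δ := by gcongr
  nlinarith

theorem IsK0Space.kadetsDist_le_rDist [CompleteSpace X] [CompleteSpace Y] (hX : IsK0Space 𝕜 X)
    (hdim : 2 ≤ Module.rank 𝕜 X) {r : ℝ} (hr : 0 < r) (hr1 : r < 1) :
    kadetsDist 𝕜 X Y ≤ 20 * 3 ^ (1 / r) * kappa0 𝕜 X * rDist 𝕜 r X Y := by
  have hk := hX.one_sixth_le_kappa0 hdim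
  have hc : (0 : ℝ) < 20 * 3 ^ (1 / r) := by positivity
  have hck : 0 < 20 * 3 ^ (1 / r) * kappa0 𝕜 X := by
    have : 0 < kappa0 𝕜 X := by linarith
    positivity
  rw [← div_le_iff₀' hck]
  refine le_csInf (rDist_set_nonempty hr hr1) ?_
  rintro _ ⟨Z, _, _, N, U, V, hN, -, hU, hV, rfl⟩
  refine le_of_forall_gt_imp_ge_of_dense fun δ hδ => ?_
  have hδ0 : 0 < δ := (gaugeHausdorffDist_nonneg hN _ _).trans_lt hδ
  obtain ⟨g₁, g₂⟩ := hN.exists_of_gaugeHausdorffDist_lt hr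
    (by rintro _ ⟨x, hx, rfl⟩; rw [hU]; simpa using hx)
    (by rintro _ ⟨x, hx, rfl⟩; rw [hV]; simpa using hx)
    (Set.Nonempty.image _ ⟨0, by simp⟩) (Set.Nonempty.image _ ⟨0, by simp⟩) hδ
  rw [div_le_iff₀' hck, mul_right_comm, ← div_le_iff₀' (by positivity)]
  -- Whether the best constant is attained is irrelevant: the bound holds for every admissible `κ`,
  -- and `hX` supplies nonemptiness.
  refine le_csInf hX fun κ hκ => ?_
  rw [div_le_iff₀' (by positivity), mul_right_comm]
  refine hκ.2.kadetsDist_le_of_rNorm (hκ.2.one_sixth_le hdim) hr hN U V hU hV hδ0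
    (fun x hx => ?_) (fun y hy => ?_)
  · obtain ⟨_, ⟨y, hy, rfl⟩, h⟩ := g₁ (U x) ⟨x, by simpa using hx, rfl⟩
    exact ⟨y, by simpa using hy, h.le⟩
  · obtain ⟨_, ⟨x, hx, rfl⟩, h⟩ := g₂ (V y) ⟨y, by simpa using hy, rfl⟩
    exact ⟨x, by simpa using hx, h.le⟩

end RDist

end BanachDist

/-! ### Approximate preservation of midpoints by reflections. -/

namespace BanachDist

section Reflection

variable {X : Type u} [NormedAddCommGroup X] [NormedSpace ℝ X]

/-- The reflection argument for the Mazur-Ulam theorem, in a local and quantitative form: a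
relation which almost preserves distances and fixes `a` and `b` almost fixes their midpoint. -/
theorem norm_sub_midpoint_le {a b z : X} (hz : z + z = a + b) (k : ℕ) :
    ∀ (G : X → X → Prop) (η T : ℝ), 0 ≤ η → G a a → G b b →
      (∀ x y x' y', G x y → G x' y' → |‖x - x'‖ - ‖y - y'‖| ≤ η) →
      (∀ x, ‖x - a‖ ≤ T → ‖x - b‖ ≤ T → ∃ y, G x y) →
      (∀ y, ‖y - a‖ ≤ T → ‖y - b‖ ≤ T → ∃ x, G x y) →
      ‖a - b‖ / 2 + (2 ^ k - 1) * η ≤ T →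
      ∀ w, G z w → ‖w - z‖ ≤ ‖a - b‖ / 2 ^ k + (1 + k / 2) * η := by
  have hza : ‖z - a‖ = ‖a - b‖ / 2 := by
    have e : a - b = -((2 : ℝ) • (z - a)) := by
      rw [two_smul, ← sub_eq_zero]
      have : z + z - (a + b) = 0 := sub_eq_zero.2 hz
      rw [← this]; abel
    rw [e, norm_neg, norm_smul, Real.norm_two]
    ring
  have hzb : ‖z - b‖ = ‖a - b‖ / 2 := by
    have e : z - b = -(z - a) := by
      rw [← sub_eq_zero]
      have : z + z - (a + b) = 0 := sub_eq_zero.2 hz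
      rw [← this]; abel
    rw [e, norm_neg, hza]
  induction k with
  | zero =>
    intro G η T hη ha hb hd hr hl hT w hw
    have h1 := (abs_le.1 (hd _ _ _ _ hw ha)).1
    have h2 := norm_sub_le_norm_sub_add_norm_sub w a z
    rw [norm_sub_rev a z] at h2
    simp only [pow_zero, CharP.cast_eq_zero]
    linarith
  | succ k ih =>
    intro G η T hη ha hb hd hr hl hT w hw
    have hpow : (1 : ℝ) ≤ 2 ^ k := one_le_pow₀ (by norm_num)
    have ea : ∀ y, ‖a + b - y - a‖ = ‖y - b‖ := fun y => by
      rw [norm_sub_rev y b]; congr 1; abel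
    have eb : ∀ y, ‖a + b - y - b‖ = ‖y - a‖ := fun y => by
      rw [norm_sub_rev y a]; congr 1; abel
    have ee : ∀ y y', ‖(a + b - y) - (a + b - y')‖ = ‖y - y'‖ := fun y y' => by
      rw [norm_sub_rev y y']; congr 1; abel
    have hga : ∀ {x y}, G x y → ‖y - a‖ ≤ ‖x - a‖ + η ∧ ‖x - a‖ ≤ ‖y - a‖ + η := fun h => by
      have := abs_le.1 (hd _ _ _ _ h ha)
      constructor <;> linarith
    have hgb : ∀ {x y}, G x y → ‖y - b‖ ≤ ‖x - b‖ + η ∧ ‖x - b‖ ≤ ‖y - b‖ + η := fun h => by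
      have := abs_le.1 (hd _ _ _ _ h hb)
      constructor <;> linarith
    have hTη : ‖a - b‖ / 2 + η ≤ T := by
      rw [pow_succ] at hT
      nlinarith
    obtain ⟨u, hu⟩ := hl (a + b - w)
      (by rw [ea]; linarith [(hgb hw).1]) (by rw [eb]; linarith [(hga hw).1])
    -- With `R y = a + b - y`, the relation used is `R G⁻¹ R G`. It again fixes `a` and `b`, has
    -- distortion `2 * η`, and has full domain and range on the region of radius `T - η`. It moves
    -- `z` about twice as far as `G` does, so the bound for `G` is half the inductive one plus `η /
    -- 2`.
    have key := ih (fun x v => ∃ y u, G x y ∧ G u (a + b - y) ∧ v = a + b - u) (2 * η) (T - η)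
      (by linarith)
      ⟨a, b, ha, by simpa using hb, by abel⟩
      ⟨b, a, hb, by simpa using ha, by abel⟩
      (by
        rintro x _ x' _ ⟨y, u, h1, h2, rfl⟩ ⟨y', u', h1', h2', rfl⟩
        have d1 := abs_le.1 (hd _ _ _ _ h1 h1')
        have d2 := abs_le.1 (hd _ _ _ _ h2 h2')
        rw [ee] at d2 ⊢
        rw [abs_le]
        constructor <;> linarith)
      (fun x h1 h2 => by
        obtain ⟨y, hy⟩ := hr x (by linarith) (by linarith)
        obtain ⟨u, hu⟩ := hl (a + b - y) (by rw [ea]; linarith [(hgb hy).1])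
          (by rw [eb]; linarith [(hga hy).1])
        exact ⟨_, y, u, hy, hu, rfl⟩)
      (fun v h1 h2 => by
        obtain ⟨t, ht⟩ := hr (a + b - v) (by rw [ea]; linarith) (by rw [eb]; linarith)
        have ha' := (hga ht).1
        have hb' := (hgb ht).1
        rw [ea] at ha'
        rw [eb] at hb'
        obtain ⟨x, hx⟩ := hl (a + b - t) (by rw [ea]; linarith) (by rw [eb]; linarith)
        exact ⟨x, a + b - t, a + b - v, hx, by simpa using ht, by abel⟩)
      (by rw [pow_succ] at hT; linarith)
      (a + b - u) ⟨w, u, hw, hu, rfl⟩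
    have e1 : ‖a + b - u - z‖ = ‖u - z‖ := by
      rw [← hz, norm_sub_rev u z]; congr 1; abel
    have e2 : ‖(a + b - w) - w‖ = 2 * ‖w - z‖ := by
      have : (a + b - w) - w = -((2 : ℝ) • (w - z)) := by
        rw [← hz, two_smul]; abel
      rw [this, norm_neg, norm_smul, Real.norm_two]
    have d := (abs_le.1 (hd _ _ _ _ hu hw)).1
    rw [e2] at d
    rw [e1] at key
    have e3 : ‖a - b‖ / 2 ^ (k + 1) = ‖a - b‖ / 2 ^ k / 2 := by rw [pow_succ, div_div]
    rw [e3]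
    push_cast
    linarith

end Reflection

/-! ### Ball correspondences: midpoints and additivity. -/

/-- A correspondence between the closed unit balls of `X` and `Y` of distortion at most `η`. -/
structure IsBallCorrespondence {X : Type u} [NormedAddCommGroup X] {Y : Type v}
    [NormedAddCommGroup Y] (E : X → Y → Prop) (η : ℝ) : Prop where
  norm_left : ∀ {x y}, E x y → ‖x‖ ≤ 1
  norm_right : ∀ {x y}, E x y → ‖y‖ ≤ 1
  exists_right : ∀ x, ‖x‖ ≤ 1 → ∃ y, E x y
  exists_left : ∀ y, ‖y‖ ≤ 1 → ∃ x, E x y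
  distortion : ∀ {x y x' y'}, E x y → E x' y' → |‖x - x'‖ - ‖y - y'‖| ≤ η

namespace IsBallCorrespondence

variable {X : Type u} [NormedAddCommGroup X] {Y : Type v} [NormedAddCommGroup Y]
  {E : X → Y → Prop} {η : ℝ}

theorem nonneg (h : IsBallCorrespondence E η) : 0 ≤ η := by
  obtain ⟨y, hy⟩ := h.exists_right 0 (by simp)
  exact (abs_nonneg _).trans (h.distortion hy hy)

variable [NormedSpace ℝ Y]

theorem norm_le_of_zero (h : IsBallCorrespondence E η) {y : Y} (hy : E 0 y) : ‖y‖ ≤ η := by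
  rcases eq_or_ne y 0 with rfl | hy0
  · simpa using h.nonneg
  have hn : ‖y‖ ≠ 0 := norm_ne_zero_iff.2 hy0
  -- The point of the sphere opposite to `y` is at distance `1 + ‖y‖` from it, while its partner is
  -- within 1 of the origin.
  obtain ⟨x, hx⟩ := h.exists_left (-(‖y‖⁻¹ • y)) (by
    rw [norm_neg, norm_smul, norm_inv, norm_norm, inv_mul_cancel₀ hn])
  have d := (abs_le.1 (h.distortion hx hy)).1
  have e : -(‖y‖⁻¹ • y) - y = -((‖y‖⁻¹ + 1) • y) := by rw [add_smul, one_smul]; abel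
  rw [e, norm_neg, norm_smul, Real.norm_of_nonneg (by positivity), add_mul, inv_mul_cancel₀ hn,
    sub_zero] at d
  linarith [h.norm_left hx]

/-- Approximate preservation of midpoints yields approximate additivity. -/
theorem norm_add_sub_le (h : IsBallCorrespondence E η) {ε : ℝ} (hηε : η ≤ ε)
    (hmid : ∀ {a b z : X} {a' b' w : Y}, ‖a‖ ≤ 1 / 4 → ‖b‖ ≤ 1 / 4 → E a a' → E b b' → E z w →
      z + z = a + b → ‖w + w - (a' + b')‖ ≤ ε) {x y : X} {p q s : Y} (hx : ‖x‖ ≤ 1 / 8)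
    (hy : ‖y‖ ≤ 1 / 8) (hp : E x p) (hq : E y q) (hs : E (x + y) s) :
    ‖s - p - q‖ ≤ 3 * ε := by
  have hx2 : ‖x + x‖ ≤ 1 / 4 := (norm_add_le _ _).trans (by linarith)
  have hy2 : ‖y + y‖ ≤ 1 / 4 := (norm_add_le _ _).trans (by linarith)
  obtain ⟨o, ho⟩ := h.exists_right 0 (by simp)
  obtain ⟨p', hp'⟩ := h.exists_right (x + x) (by linarith)
  obtain ⟨q', hq'⟩ := h.exists_right (y + y) (by linarith)
  have ho' := h.norm_le_of_zero ho
  have m1 := hmid hx2 hy2 hp' hq' hs (by abel)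
  have m2 := hmid hx2 (by simp) hp' ho hp (by abel)
  have m3 := hmid hy2 (by simp) hq' ho hq (by abel)
  -- The points `x + y`, `x`, `y` are the midpoints of the pairs `(2x, 2y)`, `(2x, 0)`, `(2y, 0)`;
  -- combining the three midpoint defects leaves only `o + o`, of norm at most `2 * η`.
  have e : (2 : ℝ) • (s - p - q) = ((s + s - (p' + q')) - (p + p - (p' + o))) -
      (q + q - (q' + o)) - (o + o) := by
    rw [two_smul]; abel
  have h2 : 2 * ‖s - p - q‖ = ‖(2 : ℝ) • (s - p - q)‖ := by rw [norm_smul, Real.norm_two]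
  rw [e] at h2
  have n1 := norm_sub_le (((s + s - (p' + q')) - (p + p - (p' + o))) - (q + q - (q' + o))) (o + o)
  have n2 := norm_sub_le ((s + s - (p' + q')) - (p + p - (p' + o))) (q + q - (q' + o))
  have n3 := norm_sub_le (s + s - (p' + q')) (p + p - (p' + o))
  have n4 := norm_add_le o o
  have := h.nonneg
  linarith

variable [NormedSpace ℝ X]

/-- Reflect in `X` by `R x = a + b - x` and in `Y` by `R' y = a' + b' - y`. The relation `E⁻¹ R' E
R` almost preserves distances and fixes `a` and `b`, so it almost fixes `z`; applying `E` once more,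
`R' w` is close to `w`. The radius `1 / 4` and the bound `1 / 12` keep all points involved inside
the unit balls. -/
theorem norm_add_self_sub_le (h : IsBallCorrespondence E η) {k : ℕ} (hk : 2 ^ k * η ≤ 1 / 12)
    {a b z : X} {a' b' w : Y} (ha : ‖a‖ ≤ 1 / 4) (hb : ‖b‖ ≤ 1 / 4) (haa : E a a') (hbb : E b b')
    (hzw : E z w) (hz : z + z = a + b) : ‖w + w - (a' + b')‖ ≤ 1 / 2 ^ k + (3 + k) * η := by
  have hη := h.nonneg
  have hpow : (1 : ℝ) ≤ 2 ^ k := one_le_pow₀ (by norm_num)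
  have hη12 : η ≤ 1 / 12 := (le_mul_of_one_le_left hη hpow).trans hk
  obtain ⟨o, ho⟩ := h.exists_right 0 (by simp)
  have ho' := h.norm_le_of_zero ho
  have hab : ‖a - b‖ ≤ 1 / 2 := (norm_sub_le _ _).trans (by linarith)
  have ha' : ‖a'‖ ≤ 1 / 4 + 2 * η := by
    have d := (abs_le.1 (h.distortion haa ho)).1
    rw [sub_zero] at d
    linarith [norm_sub_norm_le a' o]
  have ea : ∀ y, ‖a + b - y - a‖ = ‖y - b‖ := fun y => by
    rw [norm_sub_rev y b]; congr 1; abel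
  have eb : ∀ y, ‖a + b - y - b‖ = ‖y - a‖ := fun y => by
    rw [norm_sub_rev y a]; congr 1; abel
  have ea' : ∀ y, ‖a' + b' - y - a'‖ = ‖y - b'‖ := fun y => by
    rw [norm_sub_rev y b']; congr 1; abel
  have hball : ∀ x, ‖x - a‖ ≤ 1 / 2 → ‖x‖ ≤ 1 := fun x hx => by
    linarith [norm_sub_norm_le x a]
  have hball' : ∀ x y, ‖x - b‖ ≤ 1 / 2 → E x y → ‖a' + b' - y‖ ≤ 1 := fun x y hx hxy => by
    have d := (abs_le.1 (h.distortion hxy hbb)).1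
    have h1 := norm_sub_norm_le (a' + b' - y) a'
    rw [ea'] at h1
    linarith
  have hza : ‖z - b‖ ≤ 1 / 2 := by
    have e : (2 : ℝ) • (z - b) = a - b := by
      rw [two_smul]
      have : z - b + (z - b) = (z + z) - b - b := by abel
      rw [this, hz]; abel
    have h2 : 2 * ‖z - b‖ = ‖a - b‖ := by rw [← e, norm_smul, Real.norm_two]
    linarith [norm_nonneg (z - b)]
  obtain ⟨x, hx⟩ := h.exists_left (a' + b' - w) (hball' z w hza hzw)
  have key := norm_sub_midpoint_le hz k (fun x x' => ∃ y, E (a + b - x) y ∧ E x' (a' + b' - y))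
    (2 * η) (1 / 2) (by linarith) ⟨b', by simpa using hbb, by simpa using haa⟩
    ⟨a', by simpa using haa, by simpa using hbb⟩
    (by
      rintro x u x' u' ⟨y, h1, h2⟩ ⟨y', h1', h2'⟩
      have d1 := abs_le.1 (h.distortion h1 h1')
      have d2 := abs_le.1 (h.distortion h2 h2')
      have e1 : ‖(a + b - x) - (a + b - x')‖ = ‖x - x'‖ := by
        rw [norm_sub_rev x x']; congr 1; abel
      have e2 : ‖(a' + b' - y) - (a' + b' - y')‖ = ‖y - y'‖ := by
        rw [norm_sub_rev y y']; congr 1; abel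
      rw [e1] at d1
      rw [e2] at d2
      rw [abs_le]
      constructor <;> linarith)
    (fun x h1 h2 => by
      obtain ⟨y, hy⟩ := h.exists_right (a + b - x) (hball _ (by rwa [ea]))
      obtain ⟨u, hu⟩ := h.exists_left (a' + b' - y) (hball' _ y (by rwa [eb]) hy)
      exact ⟨u, y, hy, hu⟩)
    (fun u h1 h2 => by
      obtain ⟨t, ht⟩ := h.exists_right u (hball u h1)
      obtain ⟨x, hx⟩ := h.exists_left (a' + b' - t) (hball' u t h2 ht)
      exact ⟨a + b - x, a' + b' - t, by simpa using hx, by simpa using ht⟩)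
    (by linarith) x ⟨w, by rwa [← hz, add_sub_cancel_right], hx⟩
  have d := (abs_le.1 (h.distortion hzw hx)).1
  have e : ‖w - (a' + b' - w)‖ = ‖w + w - (a' + b')‖ := by congr 1; abel
  rw [e, norm_sub_rev z x] at d
  have h5 : ‖a - b‖ / 2 ^ k ≤ 1 / 2 ^ k := by gcongr; linarith
  linarith

end IsBallCorrespondence

/-! ### From almost linear to exactly homogeneous maps. -/

section AlmostLinear

variable {X : Type u} [NormedAddCommGroup X] {Y : Type v} [NormedAddCommGroup Y]

/-- `φ` is additive and isometric up to `ε` near the origin, and its values approximate the unit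
ball of `Y`. -/
structure IsAlmostLinear (φ : X → Y) (ε : ℝ) : Prop where
  zero : ‖φ 0‖ ≤ ε
  add : ∀ x y, ‖x‖ ≤ 1 / 8 → ‖y‖ ≤ 1 / 8 → ‖φ (x + y) - φ x - φ y‖ ≤ ε
  dist : ∀ x y, ‖x‖ ≤ 1 → ‖y‖ ≤ 1 → |‖x - y‖ - ‖φ x - φ y‖| ≤ ε
  surj : ∀ y, ‖y‖ ≤ 1 → ∃ x, ‖x‖ ≤ 1 ∧ ‖φ x - y‖ ≤ ε

variable {φ : X → Y} {ε : ℝ}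

theorem IsAlmostLinear.nonneg (h : IsAlmostLinear φ ε) : 0 ≤ ε := (norm_nonneg _).trans h.zero

theorem IsAlmostLinear.abs_norm_sub_le (h : IsAlmostLinear φ ε) {x : X} (hx : ‖x‖ ≤ 1) :
    |‖φ x‖ - ‖x‖| ≤ 2 * ε := by
  have d := abs_le.1 (h.dist x 0 hx (by simp))
  rw [sub_zero] at d
  have h1 := norm_sub_norm_le (φ x) (φ 0)
  have h2 := norm_sub_le (φ x) (φ 0)
  have h3 := h.zero
  rw [abs_le]
  constructor <;> linarith

variable [NormedSpace ℝ X] [NormedSpace ℝ Y]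

theorem IsAlmostLinear.norm_nsmul_sub_le (h : IsAlmostLinear φ ε) {n : ℕ} {v : X}
    (hv : n * ‖v‖ ≤ 1 / 8) {j : ℕ} (hj : j ≤ n) :
    ‖φ ((j : ℝ) • v) - (j : ℝ) • φ v‖ ≤ (j + 1) * ε := by
  induction j with
  | zero => simpa using h.zero
  | succ j ih =>
    have ih' := ih (by omega)
    have hn1 : (1 : ℝ) ≤ n := by exact_mod_cast (show 1 ≤ n by omega)
    have hjn : (j : ℝ) ≤ n := by exact_mod_cast (show j ≤ n by omega)
    have h1 : ‖(j : ℝ) • v‖ ≤ 1 / 8 := by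
      rw [norm_smul, Real.norm_of_nonneg (by positivity)]
      exact le_trans (by gcongr) hv
    have h2 : ‖v‖ ≤ 1 / 8 := (le_mul_of_one_le_left (norm_nonneg _) hn1).trans hv
    have h3 := h.add _ _ h1 h2
    push_cast
    rw [add_smul, one_smul, add_smul, one_smul]
    have e : φ ((j : ℝ) • v + v) - ((j : ℝ) • φ v + φ v) =
        (φ ((j : ℝ) • v + v) - φ ((j : ℝ) • v) - φ v) + (φ ((j : ℝ) • v) - (j : ℝ) • φ v) := by
      abel
    rw [e]
    exact (norm_add_le _ _).trans (by linarith)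

/-- Write `u = n • v` and round `s` down to `j / n`. Integer multiples are controlled by additivity,
and rounding costs about `‖v‖` twice, once inside `φ` and once outside. The error is small for `n`
large and then `ε` small. -/
theorem IsAlmostLinear.norm_smul_sub_le_of_nonneg (h : IsAlmostLinear φ ε) {n : ℕ} (hn : 0 < n)
    {u : X} (hu : ‖u‖ ≤ 1 / 8) {s : ℝ} (hs0 : 0 ≤ s) (hs1 : s ≤ 1) :
    ‖φ (s • u) - s • φ u‖ ≤ 1 / (4 * n) + (2 * n + 5) * ε := by
  have hε := h.nonneg
  have hn' : (0 : ℝ) < n := by exact_mod_cast hn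
  have hn1 : (1 : ℝ) ≤ n := by exact_mod_cast hn
  obtain ⟨v, hnv⟩ : ∃ v : X, (n : ℝ) • v = u := ⟨(n : ℝ)⁻¹ • u, smul_inv_smul₀ hn'.ne' u⟩
  set j : ℕ := ⌊s * n⌋₊ with hj
  have hvn : n * ‖v‖ ≤ 1 / 8 := by
    have : n * ‖v‖ = ‖(n : ℝ) • v‖ := by rw [norm_smul, Real.norm_of_nonneg hn'.le]
    rwa [this, hnv]
  have hv8 : ‖v‖ ≤ 1 / (8 * n) := by
    rw [← div_div, le_div_iff₀ hn']
    linarith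
  have hv1 : ‖v‖ ≤ 1 / 8 := (le_mul_of_one_le_left (norm_nonneg _) hn1).trans hvn
  have hj1 : (j : ℝ) ≤ s * n := Nat.floor_le (by positivity)
  have hj2 : s * n < j + 1 := Nat.lt_floor_add_one _
  have hjn : j ≤ n := by
    have : (j : ℝ) ≤ n := hj1.trans (mul_le_of_le_one_left hn'.le hs1)
    exact_mod_cast this
  have hjn' : (j : ℝ) ≤ n := by exact_mod_cast hjn
  have k1 := h.norm_nsmul_sub_le hvn hjn
  have k2 := h.norm_nsmul_sub_le hvn le_rfl
  rw [hnv] at k2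
  have k3 := (abs_le.1 (h.abs_norm_sub_le (hv1.trans (by norm_num)))).2
  have hsu : ‖s • u‖ ≤ 1 := by
    rw [norm_smul, Real.norm_of_nonneg hs0]
    exact (mul_le_of_le_one_left (norm_nonneg _) hs1).trans (by linarith)
  have hjv : ‖(j : ℝ) • v‖ ≤ 1 := by
    rw [norm_smul, Real.norm_of_nonneg (by positivity)]
    exact (mul_le_mul_of_nonneg_right hjn' (norm_nonneg _)).trans (by linarith)
  have k4 := (abs_le.1 (h.dist _ _ hsu hjv)).1
  have k5 : ‖s • u - (j : ℝ) • v‖ ≤ ‖v‖ := by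
    rw [← hnv, smul_smul, ← sub_smul, norm_smul, Real.norm_of_nonneg (by linarith)]
    exact mul_le_of_le_one_left (norm_nonneg _) (by linarith)
  have k6 : ‖((j : ℝ) - s * n) • φ v‖ ≤ ‖φ v‖ := by
    rw [norm_smul, Real.norm_eq_abs, abs_sub_comm, abs_of_nonneg (by linarith)]
    exact mul_le_of_le_one_left (norm_nonneg _) (by linarith)
  have k7 : ‖s • (φ u - (n : ℝ) • φ v)‖ ≤ (n + 1) * ε := by
    rw [norm_smul, Real.norm_of_nonneg hs0]
    exact (mul_le_of_le_one_left (norm_nonneg _) hs1).trans k2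
  have e : φ (s • u) - s • φ u = ((φ (s • u) - φ ((j : ℝ) • v)) +
      (φ ((j : ℝ) • v) - (j : ℝ) • φ v)) + ((j : ℝ) - s * n) • φ v -
      s • (φ u - (n : ℝ) • φ v) := by
    rw [sub_smul, smul_sub, mul_smul]; abel
  have n1 := norm_sub_le (((φ (s • u) - φ ((j : ℝ) • v)) +
      (φ ((j : ℝ) • v) - (j : ℝ) • φ v)) + ((j : ℝ) - s * n) • φ v) (s • (φ u - (n : ℝ) • φ v))
  have n2 := norm_add₃_le (a := φ (s • u) - φ ((j : ℝ) • v))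
    (b := φ ((j : ℝ) • v) - (j : ℝ) • φ v) (c := ((j : ℝ) - s * n) • φ v)
  have k8 : ((j : ℝ) + 1) * ε ≤ (n + 1) * ε := by gcongr
  have e4 : 1 / (4 * (n : ℝ)) = 1 / (8 * n) + 1 / (8 * n) := by field_simp; norm_num
  rw [e, e4]
  linarith

theorem IsAlmostLinear.norm_smul_sub_le (h : IsAlmostLinear φ ε) {n : ℕ} (hn : 0 < n)
    {u : X} (hu : ‖u‖ ≤ 1 / 8) {s : ℝ} (hs : |s| ≤ 1) :
    ‖φ (s • u) - s • φ u‖ ≤ 1 / (4 * n) + (2 * n + 7) * ε := by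
  have hε := h.nonneg
  rcases le_total 0 s with h0 | h0
  · rw [abs_of_nonneg h0] at hs
    linarith [h.norm_smul_sub_le_of_nonneg hn hu h0 hs]
  · rw [abs_of_nonpos h0] at hs
    have h1 := h.norm_smul_sub_le_of_nonneg hn hu (neg_nonneg.2 h0) hs
    have hsu : ‖s • u‖ ≤ 1 / 8 := by
      rw [norm_smul, Real.norm_of_nonpos h0]
      exact (mul_le_of_le_one_left (norm_nonneg _) hs).trans hu
    -- Almost additivity at opposite points makes `φ` almost odd, at the price of `2 * ε`.
    have h2 := h.add (s • u) (-(s • u)) hsu (by rwa [norm_neg])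
    rw [add_neg_cancel] at h2
    rw [neg_smul, neg_smul] at h1
    have e : φ (s • u) - s • φ u = φ 0 - (φ 0 - φ (s • u) - φ (-(s • u))) -
        (φ (-(s • u)) - -(s • φ u)) := by abel
    have n1 := norm_sub_le (φ 0 - (φ 0 - φ (s • u) - φ (-(s • u)))) (φ (-(s • u)) - -(s • φ u))
    have n2 := norm_sub_le (φ 0) (φ 0 - φ (s • u) - φ (-(s • u)))
    rw [← e] at n1
    linarith [h.zero]

theorem exists_eq_smul_of_norm {V : Type*} [NormedAddCommGroup V] [NormedSpace ℝ V] {x : V}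
    (hx : x ≠ 0) {c : ℝ} (hc : 0 < c) : ∃ u : V, ‖u‖ = c ∧ x = (‖x‖ / c) • u := by
  have hn : 0 < ‖x‖ := norm_pos_iff.2 hx
  refine ⟨(c / ‖x‖) • x, ?_, ?_⟩
  · rw [norm_smul, Real.norm_of_nonneg (by positivity)]
    field_simp
  · rw [smul_smul]
    field_simp
    rw [one_smul]

theorem IsAlmostLinear.exists_homogeneous (h : IsAlmostLinear φ ε) {ε' : ℝ} (hε : ε ≤ ε')
    (hs : ∀ u, ‖u‖ ≤ 1 / 8 → ∀ s : ℝ, |s| ≤ 1 → ‖φ (s • u) - s • φ u‖ ≤ ε') :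
    ∃ Φ : X → Y, (∀ (a : ℝ) x, Φ (a • x) = a • Φ x) ∧ ∀ x, ‖x‖ ≤ 1 / 8 → ‖Φ x - φ x‖ ≤ ε' := by
  obtain ⟨Φ, hΦ, hP⟩ := exists_homogeneous_selection (𝕜 := ℝ)
    -- Asking for closeness at all multiples of `x` in the small ball makes the relation
    -- scaling-invariant. It is met by extending `φ` linearly from the sphere of radius `1 / 8`.
    (fun (x : X) (y : Y) => ∀ t : ℝ, ‖t • x‖ ≤ 1 / 8 → ‖t • y - φ (t • x)‖ ≤ ε')
    (fun a x y hxy t ht => by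
      rw [smul_smul] at ht ⊢
      rw [smul_smul]
      exact hxy _ ht)
    (fun x => by
      rcases eq_or_ne x 0 with rfl | hx
      · refine ⟨0, fun t _ => ?_⟩
        rw [smul_zero, smul_zero, zero_sub, norm_neg]
        exact h.zero.trans hε
      obtain ⟨u, hu, hxu⟩ := exists_eq_smul_of_norm hx (c := 1 / 8) (by norm_num)
      refine ⟨(‖x‖ / (1 / 8)) • φ u, fun t ht => ?_⟩
      rw [norm_smul] at ht
      rw [hxu, smul_smul, smul_smul, norm_sub_rev, ← hxu]
      refine hs u hu.le _ ?_
      rw [abs_mul, abs_of_nonneg (show 0 ≤ ‖x‖ / (1 / 8) by positivity), ← Real.norm_eq_abs]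
      linarith)
  exact ⟨Φ, hΦ, fun x hx => by simpa using hP x 1 (by simpa using hx)⟩

theorem IsAlmostLinear.kadetsDist_le (h : IsAlmostLinear φ ε) {κ : ℝ}
    (hκ : IsK0Constant ℝ X κ) (hκ0 : 0 ≤ κ) {ε' : ℝ} (hε : ε ≤ ε') (hε'0 : 0 < ε')
    (hε' : ε' ≤ 1 / 48)
    (hs : ∀ u, ‖u‖ ≤ 1 / 8 → ∀ s : ℝ, |s| ≤ 1 → ‖φ (s • u) - s • φ u‖ ≤ ε') :
    kadetsDist ℝ X Y ≤ (128 * κ + 152) * ε' := by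
  obtain ⟨Φ, hΦ, hP⟩ := h.exists_homogeneous hε hs
  have hΦ0 : Φ 0 = 0 := by simpa using hΦ 0 0
  have key := hκ.kadetsDist_le hκ0 Φ hΦ (L := 32 * ε') (ε₁ := 24 * ε') (ε₂ := 32 * ε')
    (ε₃ := 48 * ε') (by positivity) (by positivity) (by positivity) (by positivity)
    (fun x₁ x₂ => by
      rcases (add_nonneg (norm_nonneg x₁) (norm_nonneg x₂)).eq_or_lt with h0 | h0
      · have h1 : x₁ = 0 := norm_eq_zero.1 (by linarith [norm_nonneg x₁, norm_nonneg x₂])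
        have h2 : x₂ = 0 := norm_eq_zero.1 (by linarith [norm_nonneg x₁, norm_nonneg x₂])
        simp [h1, h2, hΦ0]
      set t := 8 * (‖x₁‖ + ‖x₂‖) with ht
      have ht0 : 0 < t := by positivity
      have hn : ∀ x : X, ‖t⁻¹ • x‖ = t⁻¹ * ‖x‖ := fun x => by
        rw [norm_smul, Real.norm_of_nonneg (by positivity)]
      have hle : ∀ x : X, ‖x‖ ≤ ‖x₁‖ + ‖x₂‖ → ‖t⁻¹ • x‖ ≤ 1 / 8 := fun x hx => by
        rw [hn, inv_mul_le_iff₀ ht0]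
        linarith
      have l1 := hle x₁ (by linarith [norm_nonneg x₂])
      have l2 := hle x₂ (by linarith [norm_nonneg x₁])
      have l3 := hle (x₁ + x₂) (norm_add_le _ _)
      have p1 := hP _ l1
      have p2 := hP _ l2
      have p3 := hP _ l3
      have p4 := h.add _ _ l1 l2
      rw [← smul_add] at p4
      have e : t⁻¹ • (Φ (x₁ + x₂) - Φ x₁ - Φ x₂) =
          (Φ (t⁻¹ • (x₁ + x₂)) - φ (t⁻¹ • (x₁ + x₂))) - (Φ (t⁻¹ • x₁) - φ (t⁻¹ • x₁)) -
          (Φ (t⁻¹ • x₂) - φ (t⁻¹ • x₂)) +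
          (φ (t⁻¹ • (x₁ + x₂)) - φ (t⁻¹ • x₁) - φ (t⁻¹ • x₂)) := by
        rw [hΦ, hΦ, hΦ, smul_sub, smul_sub]; abel
      have n0 : ‖t⁻¹ • (Φ (x₁ + x₂) - Φ x₁ - Φ x₂)‖ ≤ 4 * ε' := by
        rw [e]
        refine (norm_add_le _ _).trans ?_
        have n1 := norm_sub_le ((Φ (t⁻¹ • (x₁ + x₂)) - φ (t⁻¹ • (x₁ + x₂))) -
          (Φ (t⁻¹ • x₁) - φ (t⁻¹ • x₁))) (Φ (t⁻¹ • x₂) - φ (t⁻¹ • x₂))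
        have n2 := norm_sub_le (Φ (t⁻¹ • (x₁ + x₂)) - φ (t⁻¹ • (x₁ + x₂)))
          (Φ (t⁻¹ • x₁) - φ (t⁻¹ • x₁))
        linarith
      rw [norm_smul, Real.norm_of_nonneg (by positivity), inv_mul_le_iff₀ ht0] at n0
      linarith)
    (fun x => by
      rcases eq_or_ne x 0 with rfl | hx
      · simp [hΦ0]
      obtain ⟨u, hu, hxu⟩ := exists_eq_smul_of_norm hx (c := 1 / 8) (by norm_num)
      have h1 := abs_le.1 (h.abs_norm_sub_le (x := u) (by rw [hu]; norm_num))
      have h2 := abs_le.1 ((abs_norm_sub_norm_le (Φ u) (φ u)).trans (hP u hu.le))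
      have h3 : ‖Φ x‖ = 8 * ‖x‖ * ‖Φ u‖ := by
        conv_lhs => rw [hxu]
        rw [hΦ, norm_smul, Real.norm_of_nonneg (by positivity)]
        ring
      have h4 : ‖Φ x‖ - ‖x‖ = 8 * ‖x‖ * (‖Φ u‖ - ‖u‖) := by
        rw [mul_sub, ← h3, hu]; ring
      have h5 : |‖Φ u‖ - ‖u‖| ≤ 3 * ε' := by
        rw [abs_le]
        constructor <;> linarith
      rw [h4, abs_mul, abs_of_nonneg (by positivity)]
      calc 8 * ‖x‖ * |‖Φ u‖ - ‖u‖| ≤ 8 * ‖x‖ * (3 * ε') := by gcongr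
        _ = 24 * ε' * ‖x‖ := by ring)
    (fun y => by
      rcases eq_or_ne y 0 with rfl | hy
      · exact ⟨0, by simp, by simp [hΦ0]⟩
      -- Radius `1 / 16` leaves room for the preimage: its norm is at most `1 / 16 + 3 * ε'`, hence
      -- at most `1 / 8` as `ε' ≤ 1 / 48`, so `Φ` is still close to `φ` there.
      obtain ⟨u, hu, hyu⟩ := exists_eq_smul_of_norm hy (c := 1 / 16) (by norm_num)
      obtain ⟨x, hx, hxu⟩ := h.surj u (by rw [hu]; norm_num)
      have h1 := (abs_le.1 (h.abs_norm_sub_le hx)).1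
      have h2 := norm_sub_norm_le (φ x) u
      have h3 : ‖x‖ ≤ 1 / 16 + 3 * ε' := by linarith
      have h4 := hP x (by linarith)
      have h5 : ‖Φ x - u‖ ≤ 2 * ε' := by
        have := norm_sub_le_norm_sub_add_norm_sub (Φ x) (φ x) u
        linarith
      have hc : (0 : ℝ) ≤ ‖y‖ / (1 / 16) := by positivity
      refine ⟨(‖y‖ / (1 / 16)) • x, ?_, ?_⟩
      · rw [norm_smul, Real.norm_of_nonneg hc]
        calc ‖y‖ / (1 / 16) * ‖x‖ ≤ ‖y‖ / (1 / 16) * (1 / 16 + 3 * ε') := by gcongr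
          _ = (1 + 48 * ε') * ‖y‖ := by ring
      · have e : Φ ((‖y‖ / (1 / 16)) • x) - y = (‖y‖ / (1 / 16)) • (Φ x - u) := by
          rw [hΦ, smul_sub, ← hyu]
        rw [e, norm_smul, Real.norm_of_nonneg hc]
        calc ‖y‖ / (1 / 16) * ‖Φ x - u‖ ≤ ‖y‖ / (1 / 16) * (2 * ε') := by gcongr
          _ = 32 * ε' * ‖y‖ := by ring)
  refine key.trans ?_
  have h1 : 1 + 48 * ε' ≤ 2 := by linarith
  have h2 : 0 ≤ 2 * κ * (32 * ε') + 24 * ε' := by positivity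
  linarith [mul_le_mul_of_nonneg_left h1 h2]

end AlmostLinear

/-! ### From Gromov-Hausdorff distance to Kadets distance. -/

theorem IsBallCorrespondence.exists_isAlmostLinear
    {X : Type u} [NormedAddCommGroup X] [NormedSpace ℝ X]
    {Y : Type v} [NormedAddCommGroup Y] [NormedSpace ℝ Y] {E : X → Y → Prop} {η : ℝ}
    (h : IsBallCorrespondence E η) {k : ℕ} (hk : 2 ^ k * η ≤ 1 / 12) {ε : ℝ}
    (hε : 1 / 2 ^ k + (3 + k) * η ≤ ε) : ∃ φ : X → Y, IsAlmostLinear φ (3 * ε) := by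
  have hη := h.nonneg
  have hηε : η ≤ ε := by
    have h1 : (0 : ℝ) ≤ 1 / 2 ^ k := by positivity
    have h2 : (0 : ℝ) ≤ k * η := by positivity
    linarith
  have hex : ∀ x : X, ∃ y : Y, ‖x‖ ≤ 1 → E x y := fun x => by
    by_cases hx : ‖x‖ ≤ 1
    · obtain ⟨y, hy⟩ := h.exists_right x hx
      exact ⟨y, fun _ => hy⟩
    · exact ⟨0, fun hx' => absurd hx' hx⟩
  choose φ hφ using hex
  refine ⟨φ, ⟨?_, fun x y hx hy => ?_, fun x y hx hy => ?_, fun y hy => ?_⟩⟩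
  · linarith [h.norm_le_of_zero (hφ 0 (by simp))]
  · refine h.norm_add_sub_le hηε (fun ha hb haa hbb hzw hz =>
      (h.norm_add_self_sub_le hk ha hb haa hbb hzw hz).trans hε) hx hy (hφ x (by linarith))
      (hφ y (by linarith)) (hφ _ ?_)
    exact (norm_add_le _ _).trans (by linarith)
  · linarith [h.distortion (hφ x hx) (hφ y hy)]
  · obtain ⟨x, hx⟩ := h.exists_left y hy
    have h1 := h.norm_left hx
    have d := (abs_le.1 (h.distortion (hφ x h1) hx)).1
    rw [sub_self, norm_zero] at d
    exact ⟨x, h1, by linarith⟩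

theorem isBounded_range_of_isometry {V : Type u} [NormedAddCommGroup V] {M : Type v}
    [PseudoMetricSpace M] {f : Metric.closedBall (0 : V) 1 → M} (hf : Isometry f) :
    Bornology.IsBounded (Set.range f) := by
  refine Metric.isBounded_range_iff.2 ⟨2, fun x y => ?_⟩
  rw [hf.dist_eq, Subtype.dist_eq, dist_eq_norm]
  have hx := x.2
  have hy := y.2
  rw [mem_closedBall_zero_iff] at hx hy
  exact (norm_sub_le _ _).trans (by linarith)

theorem exists_isBallCorrespondence {X : Type u} [NormedAddCommGroup X]
    {Y : Type v} [NormedAddCommGroup Y] {η : ℝ} (h : ballGHDist Y X < η) :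
    ∃ E : X → Y → Prop, IsBallCorrespondence E (2 * η) := by
  -- A competitor can be extracted from an infimum only if there is one; both balls embed in `Y ×
  -- X`.
  have hne : {ε : ℝ | 0 ≤ ε ∧ ∃ (M : Type (max u v)) (_ : PseudoMetricSpace M)
      (i : Metric.closedBall (0 : Y) 1 → M) (j : Metric.closedBall (0 : X) 1 → M),
      Isometry i ∧ Isometry j ∧
        Metric.hausdorffDist (Set.range i) (Set.range j) ≤ ε}.Nonempty := by
    refine ⟨_, Metric.hausdorffDist_nonneg, Y × X, inferInstance, fun y => (y, 0), fun x => (0, x),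
      ?_, ?_, le_rfl⟩
    · exact Isometry.of_dist_eq fun y y' => by simp [Prod.dist_eq, Subtype.dist_eq]
    · exact Isometry.of_dist_eq fun y y' => by simp [Prod.dist_eq, Subtype.dist_eq]
  obtain ⟨ε, ⟨hε0, M, _, i, j, hi, hj, hd⟩, hεη⟩ := exists_lt_of_csInf_lt hne h
  have hlt := hd.trans_lt hεη
  have : Nonempty (Metric.closedBall (0 : Y) 1) := ⟨⟨0, by simp⟩⟩
  have : Nonempty (Metric.closedBall (0 : X) 1) := ⟨⟨0, by simp⟩⟩
  have hfin : Metric.hausdorffEDist (Set.range i) (Set.range j) ≠ ⊤ :=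
    Metric.hausdorffEDist_ne_top_of_nonempty_of_bounded (Set.range_nonempty _)
      (Set.range_nonempty _) (isBounded_range_of_isometry hi) (isBounded_range_of_isometry hj)
  refine ⟨fun x y => ∃ (hx : x ∈ Metric.closedBall (0 : X) 1)
    (hy : y ∈ Metric.closedBall (0 : Y) 1), dist (i ⟨y, hy⟩) (j ⟨x, hx⟩) < η,
    ⟨fun ⟨hx, _, _⟩ => by simpa using hx, fun ⟨_, hy, _⟩ => by simpa using hy,
      fun x hx => ?_, fun y hy => ?_, ?_⟩⟩
  · obtain ⟨_, ⟨y, rfl⟩, hy⟩ := Metric.exists_dist_lt_of_hausdorffDist_lt'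
      (Set.mem_range_self ⟨x, by simpa using hx⟩) hlt hfin
    exact ⟨y, by simpa using hx, y.2, hy⟩
  · obtain ⟨_, ⟨x, rfl⟩, hx⟩ := Metric.exists_dist_lt_of_hausdorffDist_lt
      (Set.mem_range_self ⟨y, by simpa using hy⟩) hlt hfin
    exact ⟨x, x.2, by simpa using hy, hx⟩
  · rintro x y x' y' ⟨hx, hy, h1⟩ ⟨hx', hy', h2⟩
    have e1 : ‖x - x'‖ = dist (j ⟨x, hx⟩) (j ⟨x', hx'⟩) := by
      rw [hj.dist_eq, Subtype.dist_eq, dist_eq_norm]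
    have e2 : ‖y - y'‖ = dist (i ⟨y, hy⟩) (i ⟨y', hy'⟩) := by
      rw [hi.dist_eq, Subtype.dist_eq, dist_eq_norm]
    have t1 := dist_triangle4_left (i ⟨y, hy⟩) (i ⟨y', hy'⟩) (j ⟨x, hx⟩) (j ⟨x', hx'⟩)
    have t2 := dist_triangle4_right (i ⟨y, hy⟩) (i ⟨y', hy'⟩) (j ⟨x, hx⟩) (j ⟨x', hx'⟩)
    rw [e1, e2, abs_le]
    constructor <;> linarith

/-- The Kadets distance to a real `𝒦₀`-space is controlled by the Gromov-Hausdorff distance of the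
unit balls, with a modulus depending only on the `𝒦₀`-space. -/
theorem IsK0Space.exists_kadetsDist_le {X : Type u} [NormedAddCommGroup X] [NormedSpace ℝ X]
    (hX : IsK0Space ℝ X) {δ : ℝ} (hδ : 0 < δ) :
    ∃ η > 0, ∀ (Y : Type v) [NormedAddCommGroup Y] [NormedSpace ℝ Y],
      ballGHDist Y X < η → kadetsDist ℝ Y X ≤ δ := by
  obtain ⟨κ, hκ0, hκ⟩ := hX
  have hc : 0 < 128 * κ + 152 := by positivity
  obtain ⟨ε', hε'0, hε'1, hε'2⟩ : ∃ ε' : ℝ, 0 < ε' ∧ ε' ≤ 1 / 48 ∧ (128 * κ + 152) * ε' ≤ δ :=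
    ⟨min (1 / 48) (δ / (128 * κ + 152)), by positivity, min_le_left _ _, by
      rw [← le_div_iff₀' hc]
      exact min_le_right _ _⟩
  -- Order of choices: `ε'` from `κ` and `δ`, then `n` from `ε'`, `ε` from `n`, `k` from `ε`, and
  -- finally `η` from `k` and `ε`. None depends on `Y`.
  obtain ⟨m, hm⟩ := exists_nat_one_div_lt (show 0 < 2 * ε' by positivity)
  set n := m + 1 with hn
  have hn0 : (0 : ℝ) < n := by positivity
  have hn4 : 1 / (4 * (n : ℝ)) ≤ ε' / 2 := by
    have : 1 / (4 * (n : ℝ)) = 1 / n / 4 := by rw [div_div, mul_comm]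
    rw [this, hn]
    push_cast
    linarith
  obtain ⟨ε, hε0, hε⟩ : ∃ ε : ℝ, 0 < ε ∧ (2 * n + 7) * (3 * ε) ≤ ε' / 2 :=
    ⟨ε' / 2 / (2 * n + 7) / 3, by positivity, le_of_eq (by field_simp)⟩
  have hεε' : 3 * ε ≤ ε' := by
    have : 0 ≤ (n : ℝ) * ε := by positivity
    linarith
  obtain ⟨k, hk⟩ := exists_pow_lt_of_lt_one (show 0 < ε / 2 by positivity)
    (show (1 / 2 : ℝ) < 1 by norm_num)
  rw [one_div_pow] at hk
  have hpow : (0 : ℝ) < 2 ^ k := by positivity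
  refine ⟨min (1 / 24 / 2 ^ k) (ε / 4 / (3 + k)), by positivity, fun Y _ _ hY => ?_⟩
  obtain ⟨E, hE⟩ := exists_isBallCorrespondence hY
  set η := min (1 / 24 / 2 ^ k) (ε / 4 / (3 + k)) with hη
  have h1 : 2 ^ k * η ≤ 1 / 24 := by
    rw [← le_div_iff₀' hpow]
    exact min_le_left _ _
  have h2 : (3 + k) * η ≤ ε / 4 := by
    rw [← le_div_iff₀' (by positivity)]
    exact min_le_right _ _
  obtain ⟨φ, hφ⟩ := hE.exists_isAlmostLinear (k := k) (ε := ε) (by linarith) (by linarith)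
  rw [kadetsDist_comm]
  refine (hφ.kadetsDist_le hκ hκ0 hεε' hε'0 hε'1 fun u hu s hs => ?_).trans hε'2
  exact (hφ.norm_smul_sub_le (n := n) (by omega) hu hs).trans (by linarith)

end BanachDist

theorem theorem3p7 :
    (∀ r : ℝ, 0 < r → r < 1 → ∃ C : ℝ, 0 < C ∧
      ∀ (𝕜 : Type) [RCLike 𝕜]
        (X : Type u) [NormedAddCommGroup X] [NormedSpace 𝕜 X] [CompleteSpace X],
        2 ≤ Module.rank 𝕜 X → BanachDist.IsK0Space 𝕜 X →
        ∀ (Y : Type v) [NormedAddCommGroup Y] [NormedSpace 𝕜 Y] [CompleteSpace Y],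
          BanachDist.kadetsDist 𝕜 X Y ≤
            C * BanachDist.kappa0 𝕜 X * BanachDist.rDist 𝕜 r X Y) ∧
    (∀ (X : Type u) [NormedAddCommGroup X] [NormedSpace ℝ X] [CompleteSpace X],
      BanachDist.IsK0Space ℝ X →
      ∀ (Xs : ℕ → Type v) [∀ n, NormedAddCommGroup (Xs n)] [∀ n, NormedSpace ℝ (Xs n)]
        [∀ n, CompleteSpace (Xs n)],
        Filter.Tendsto (fun n => BanachDist.ballGHDist (Xs n) X) Filter.atTop (nhds 0) →
        Filter.Tendsto (fun n => BanachDist.kadetsDist ℝ (Xs n) X) Filter.atTop (nhds 0)) := by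
  refine ⟨fun r hr hr1 => ⟨20 * 3 ^ (1 / r), by positivity, ?_⟩, ?_⟩
  · intro 𝕜 _ X _ _ _ hdim hX Y _ _ _
    exact hX.kadetsDist_le_rDist hdim hr hr1
  · intro X _ _ _ hX Xs _ _ _ hlim
    rw [Metric.tendsto_atTop]
    intro δ hδ
    obtain ⟨η, hη, h⟩ := hX.exists_kadetsDist_le (half_pos hδ)
    obtain ⟨n₀, hn₀⟩ := Filter.eventually_atTop.1 (hlim.eventually (gt_mem_nhds hη))
    refine ⟨n₀, fun n hn => ?_⟩
    rw [Real.dist_0_eq_abs, abs_of_nonneg (BanachDist.kadetsDist_nonneg _ _ _)]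
    linarith [h (Xs n) (hn₀ n hn)]
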